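/- **Setting.** For each sample size $n$ let $p=p_n\ge 1$, let $\mathbf X=\mathbf X_n$ be a fixed real $n\times p$ design matrix and $\beta^*=\beta^*_n\in\mathbb R^p$, and let $\mathbf y=\mathbf X\beta^*+\varepsilon$, where the coordinates $\varepsilon_1,\dots,\varepsilon_n$ of $\varepsilon$ are i.i.d. with a law that does not depend on $n$, mean zero and finite variance $\sigma^2$. Let $\mathcal A=\{j:\beta^*_j\ne 0\}$, let $\mathbf X_{\mathcal A}$ consist of the columns of $\mathbf X$ with index in $\mathcal A$, and let $\lambda_1,\lambda_2,\lambda_1^*\ge 0$ be deterministic and depend on $n$. The elastic-net estimator is $$\hat\beta(\mathrm{enet})=\Bigl(1+\frac{\lambda_2}{n}\Bigr)\arg\min_{\beta\in\mathbb R^p}\Bigl\{\|\mathbf y-\mathbf X\beta\|_2^2+\lambda_2\|\beta\|_2^2+\lambda_1\|\beta\|_1\Bigr\},$$ and the adaptive weights are $\hat w_j=|\hat\beta_j(\mathrm{enet})|^{-\gamma}$, with $\hat w_j=\infty$ if $\hat\beta_j(\mathrm{enet})=0$ (and $\infty\cdot 0=0$), or alternatively $\hat w_j=(|\hat\beta_j(\mathrm{enet})|+1/n)^{-\gamma}$.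 The adaptive elastic-net estimator is $$\hat\beta(\mathrm{AdaEnet})=\Bigl(1+\frac{\lambda_2}{n}\Bigr)\arg\min_{\beta\in\mathbb R^p}\Bigl\{\|\mathbf y-\mathbf X\beta\|_2^2+\lambda_2\|\beta\|_2^2+\lambda_1^*\sum_{j=1}^p\hat w_j|\beta_j|\Bigr\}.\qquad(2.2)$$ **Assumptions.** (A1) There are constants $b,B>0$ such that, for all large $n$, $b\le\lambda_{\min}(\frac1n\mathbf X^T\mathbf X)\le\lambda_{\max}(\frac1n\mathbf X^T\mathbf X)\le B$. (A2) $\frac1n\max_{1\le i\le n}\sum_{j=1}^p x_{ij}^2\to 0$. (A3) $E|\varepsilon_1|^{2+\delta}<\infty$ for some $\delta>0$. (A4) $\log p/\log n\to\nu$ for some $0\le\nu<1$; if $\nu=0$, then $p$ is bounded (the finite-dimensional setting). The number $\gamma$ is fixed, with $\gamma>\frac{2\nu}{1-\nu}$. (A5) $\lambda_2/n\to0$ and $\lambda_1/\sqrt n\to 0$. (A6) $\frac{\lambda_1^*}{\sqrt n}\to0$, $\ \frac{\lambda_1^*}{\sqrt n}n^{((1-\nu)(1+\gamma)-1)/2}\to\infty$,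 $\ \frac{\lambda_2}{\sqrt n}\sqrt{\sum_{j\in\mathcal A}\beta_j^{*2}}\to0$, and $$\min\Bigl(\frac{n}{\lambda_1\sqrt p},\Bigl(\frac{\sqrt n}{\sqrt p\,\lambda_1^*}\Bigr)^{1/\gamma}\Bigr)\,\min_{j\in\mathcal A}|\beta_j^*|\to\infty,$$ where $1/0=\infty$ and the minimum over the empty set is $\infty$. **Theorem 3.2.** Define the oracle fit $$\tilde\beta^*_{\mathcal A}=\arg\min_{\beta\in\mathbb R^{\mathcal A}}\Bigl\{\|\mathbf y-\mathbf X_{\mathcal A}\beta\|_2^2+\lambda_2\sum_{j\in\mathcal A}\beta_j^2+\lambda_1^*\sum_{j\in\mathcal A}\hat w_j|\beta_j|\Bigr\}.$$ Under (A1)–(A6), with probability tending to $1$ as $n\to\infty$, the minimizers defining $\hat\beta(\mathrm{enet})$ and $\tilde\beta^*_{\mathcal A}$ exist and are unique, and the vector $\bigl((1+\frac{\lambda_2}{n})\tilde\beta^*_{\mathcal A},\,0\bigr)$ (with zeros on $\mathcal A^c$) is the unique solution of (2.2). This holds for each of the two conventions for $\hat w_j$. -/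

import Mathlib

open MeasureTheory ProbabilityTheory Filter Topology
open scoped ENNReal Matrix

namespace AdaEnet

/-- The penalized least squares criterion
`‖y - X β‖₂² + l2 * ‖β‖₂² + l1 * ∑ j, w j * |β j|`, with weights `w j ∈ [0, ∞]`.
It takes values in `[0, ∞]`, with `∞ * 0 = 0`: an infinite weight `w j` forces `β j = 0`
as soon as `l1 > 0`. It is used with `l2, l1 ≥ 0`. -/
noncomputable def penLoss {n : ℕ} {ι : Type*} [Fintype ι]
    (X : Matrix (Fin n) ι ℝ) (y : Fin n → ℝ) (l2 l1 : ℝ) (w : ι → ℝ≥0∞) (β : ι → ℝ) : ℝ≥0∞ :=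
  ENNReal.ofReal ((∑ i, (y i - (X *ᵥ β) i) ^ 2) + l2 * ∑ j, β j ^ 2)
    + ENNReal.ofReal l1 * ∑ j, w j * ENNReal.ofReal |β j|

/-- The set of all global minimizers (the `arg min`) of the criterion `penLoss`. -/
def penArgmin {n : ℕ} {ι : Type*} [Fintype ι]
    (X : Matrix (Fin n) ι ℝ) (y : Fin n → ℝ) (l2 l1 : ℝ) (w : ι → ℝ≥0∞) : Set (ι → ℝ) :=
  {β | ∀ β', penLoss X y l2 l1 w β ≤ penLoss X y l2 l1 w β'}

/-- The solution set of the weighted elastic-net problem, i.e. the rescaled minimizers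
`(1 + l2 / n) * argmin`. -/
def weightedEnet {n : ℕ} {ι : Type*} [Fintype ι]
    (X : Matrix (Fin n) ι ℝ) (y : Fin n → ℝ) (l2 l1 : ℝ) (w : ι → ℝ≥0∞) : Set (ι → ℝ) :=
  (fun β : ι → ℝ => (1 + l2 / (n : ℝ)) • β) '' penArgmin X y l2 l1 w

/-- The solution set of the elastic-net problem: all weights are `1`. -/
def enet {n : ℕ} {ι : Type*} [Fintype ι]
    (X : Matrix (Fin n) ι ℝ) (y : Fin n → ℝ) (l2 l1 : ℝ) : Set (ι → ℝ) :=
  weightedEnet X y l2 l1 (fun _ => 1)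

/-- The adaptive weights `(|b j| + τ) ^ (-γ)`. For `τ = 0` and `γ > 0` the weight is `∞`
exactly when `b j = 0`. -/
noncomputable def adaWeight {ι : Type*} (γ τ : ℝ) (b : ι → ℝ) : ι → ℝ≥0∞ :=
  fun j => ENNReal.ofReal (|b j| + τ) ^ (-γ)

/-- The active set `{j | β j ≠ 0}`, as a type. -/
abbrev Active {ι : Type*} (β : ι → ℝ) : Type _ := {j : ι // β j ≠ 0}

/-- The columns of `X` whose index is in the active set of `β`. -/
def activeCols {n : ℕ} {ι : Type*} (X : Matrix (Fin n) ι ℝ) (β : ι → ℝ) :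
    Matrix (Fin n) (Active β) ℝ :=
  X.submatrix id Subtype.val

/-- The vector `(v, 0)`: it is `v` on the active set of `β` and zero off it. -/
noncomputable def zeroExtend {ι : Type*} (β : ι → ℝ) (v : Active β → ℝ) : ι → ℝ :=
  Function.extend Subtype.val v 0

/-- The response of the linear model, `y = X β + ε`, with the first `n` errors. -/
def response {n : ℕ} {ι : Type*} [Fintype ι]
    (X : Matrix (Fin n) ι ℝ) (β : ι → ℝ) (ε : ℕ → ℝ) : Fin n → ℝ :=
  fun i => (X *ᵥ β) i + ε i

/-- The event of interest, for true coefficients `βs` and data `(y, X)`: the elastic-net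
estimator `bE` exists and is unique; with the adaptive weights computed from it, the oracle
problem, which uses only the active columns, has a unique minimizer `v`; and
`((1 + l2 / n) v, 0)` is the one and only solution of the adaptive elastic-net problem, which
uses all columns. Here `l1` is the `ℓ₁` parameter of the elastic-net and `l1s` that of the
adaptive elastic-net. -/
def OracleSolves {n : ℕ} {ι : Type*} [Fintype ι]
    (X : Matrix (Fin n) ι ℝ) (βs : ι → ℝ) (y : Fin n → ℝ) (l2 l1 l1s γ τ : ℝ) : Prop :=
  ∃ (bE : ι → ℝ) (v : Active βs → ℝ),
    enet X y l2 l1 = {bE} ∧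
    penArgmin (activeCols X βs) y l2 l1s (fun j => adaWeight γ τ bE j.1) = {v} ∧
    weightedEnet X y l2 l1s (adaWeight γ τ bE) =
      {zeroExtend βs ((1 + l2 / (n : ℝ)) • v)}

end AdaEnet

/-! The criterion is strongly convex by the lower eigenvalue bound, so its minimizer is unique and
characterized by coordinatewise KKT conditions. It therefore suffices to check that the oracle fit
`v`, padded with zeros, is stationary for the full problem: each inactive column must satisfy `2 *
|x_jᵀ (y - X_A v)| ≤ l1s * w_j`.

Right side: Markov's inequality for the squared scores puts the elastic net within `R`, of order
`√(p / n)`, of the truth, so inactive weights are at least `(R + τ) ^ (-γ)`. Active coefficients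
exceed `2 * R`, so their weights are at most `(|βs j| / 2) ^ (-γ)`.

Left side: `v` depends on the errors through the weights, so the residual is not a linear form in
them. Ridge regression of `x_j` on the active columns, with coefficients `d_j` and residual `a_j`,
gives `x_jᵀ (y - X_A v) = a_jᵀ ε + d_jᵀ (l2 βs + score v)`. The vector `a_j` is deterministic with
squared norm at most `n B`, and the beta-min and ridge conditions make the second term `O(√n)`. This
is `exists_oracleSolves_of_bounds`.

It remains to bound `max_j |a_jᵀ ε|` by `D √n` with `D √n (p / n) ^ (γ / 2)` negligible against
`l1s` (`exists_noise_level`). For bounded `p` a constant `D` and Chebyshev suffice. For `ν > 0`, `p`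
is only known up to a factor `n ^ o(1)`, and Chebyshev is just too weak; the moment above two, used
by truncation with Hoeffding's inequality, permits `D = n ^ (ν / 2 - κ)`, a polynomial gain that
absorbs this factor. -/

namespace AdaEnet

/-! ### KKT conditions, existence and uniqueness of minimizers. -/

section Deterministic

variable {n : ℕ} {ι : Type*} [Fintype ι]

/-- The smooth part of the criterion. -/
def ridgeLoss (X : Matrix (Fin n) ι ℝ) (y : Fin n → ℝ) (l2 : ℝ) (β : ι → ℝ) : ℝ :=
  (∑ i, (y i - (X *ᵥ β) i) ^ 2) + l2 * ∑ j, β j ^ 2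

/-- Minus one half of the gradient of `ridgeLoss`. -/
def score (X : Matrix (Fin n) ι ℝ) (y : Fin n → ℝ) (l2 : ℝ) (β : ι → ℝ) (j : ι) : ℝ :=
  (∑ i, X i j * (y i - (X *ᵥ β) i)) - l2 * β j

/-- The Karush-Kuhn-Tucker conditions for `ridgeLoss + ∑ j, w j * |β j|`. -/
def IsStationary (X : Matrix (Fin n) ι ℝ) (y : Fin n → ℝ) (l2 : ℝ) (w β : ι → ℝ) : Prop :=
  ∀ j t, 0 ≤ -2 * score X y l2 β j * t + w j * (|β j + t| - |β j|)

lemma sum_sum_mul_eq_sum_mulVec (X : Matrix (Fin n) ι ℝ) (r : Fin n → ℝ) (h : ι → ℝ) :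
    ∑ j, (∑ i, X i j * r i) * h j = ∑ i, (X *ᵥ h) i * r i := by
  simp only [Matrix.mulVec, dotProduct, Finset.sum_mul]
  rw [Finset.sum_comm]
  exact Finset.sum_congr rfl fun i _ => Finset.sum_congr rfl fun j _ => by ring

lemma sum_score_mul (X : Matrix (Fin n) ι ℝ) (y : Fin n → ℝ) (l2 : ℝ) (β h : ι → ℝ) :
    ∑ j, score X y l2 β j * h j =
      (∑ i, (X *ᵥ h) i * (y i - (X *ᵥ β) i)) - l2 * ∑ j, β j * h j := by
  rw [← sum_sum_mul_eq_sum_mulVec, Finset.mul_sum, ← Finset.sum_sub_distrib]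
  exact Finset.sum_congr rfl fun j _ => by rw [score]; ring

lemma ridgeLoss_add (X : Matrix (Fin n) ι ℝ) (y : Fin n → ℝ) (l2 : ℝ) (β h : ι → ℝ) :
    ridgeLoss X y l2 (β + h) = ridgeLoss X y l2 β - 2 * ∑ j, score X y l2 β j * h j
      + ∑ i, (X *ᵥ h) i ^ 2 + l2 * ∑ j, h j ^ 2 := by
  rw [sum_score_mul]
  have e1 : ∑ i, (y i - (X *ᵥ (β + h)) i) ^ 2 = ∑ i, (y i - (X *ᵥ β) i) ^ 2
      - 2 * ∑ i, (X *ᵥ h) i * (y i - (X *ᵥ β) i) + ∑ i, (X *ᵥ h) i ^ 2 := by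
    rw [Finset.mul_sum, ← Finset.sum_sub_distrib, ← Finset.sum_add_distrib]
    refine Finset.sum_congr rfl fun i _ => ?_
    rw [Matrix.mulVec_add, Pi.add_apply]; ring
  have e2 : ∑ j, (β + h) j ^ 2 = ∑ j, β j ^ 2 + 2 * ∑ j, β j * h j + ∑ j, h j ^ 2 := by
    rw [Finset.mul_sum, ← Finset.sum_add_distrib, ← Finset.sum_add_distrib]
    refine Finset.sum_congr rfl fun i _ => ?_
    rw [Pi.add_apply]; ring
  rw [ridgeLoss, ridgeLoss, e1, e2]; ring

/-- The coordinatewise conditions with `t = (β' - β) j` sum up to cancel the linear term of the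
exact expansion `ridgeLoss_add`. The quadratic surplus is the source of both uniqueness and the
error bound. -/
lemma IsStationary.quadratic_growth {X : Matrix (Fin n) ι ℝ} {y : Fin n → ℝ} {l2 : ℝ}
    {w β : ι → ℝ} (hβ : IsStationary X y l2 w β) (β' : ι → ℝ) :
    ridgeLoss X y l2 β + ∑ j, w j * |β j| + ∑ i, (X *ᵥ (β' - β)) i ^ 2
        + l2 * ∑ j, (β' - β) j ^ 2
      ≤ ridgeLoss X y l2 β' + ∑ j, w j * |β' j| := by
  have h1 := ridgeLoss_add X y l2 β (β' - β)
  rw [add_sub_cancel] at h1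
  have h2 : 0 ≤ ∑ j, (-2 * score X y l2 β j * (β' - β) j + w j * (|β' j| - |β j|)) :=
    Finset.sum_nonneg fun j _ => by
      have := hβ j ((β' - β) j)
      rwa [Pi.sub_apply, add_sub_cancel] at this
  have h3 : ∑ j, (-2 * score X y l2 β j * (β' - β) j + w j * (|β' j| - |β j|))
      = -2 * ∑ j, score X y l2 β j * (β' - β) j + (∑ j, w j * |β' j| - ∑ j, w j * |β j|) := by
    rw [Finset.mul_sum, ← Finset.sum_sub_distrib, ← Finset.sum_add_distrib]
    exact Finset.sum_congr rfl fun j _ => by ring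
  linarith

lemma IsStationary.abs_score_le {X : Matrix (Fin n) ι ℝ} {y : Fin n → ℝ} {l2 : ℝ}
    {w β : ι → ℝ} (hβ : IsStationary X y l2 w β) (hw : ∀ j, 0 ≤ w j) (j : ι) :
    |score X y l2 β j| ≤ w j / 2 := by
  have h1 := hβ j 1
  have h2 := hβ j (-1)
  have a1 : |β j + 1| - |β j| ≤ 1 := by
    have := abs_add_le (β j) 1; rw [abs_one] at this; linarith
  have a2 : |β j + -1| - |β j| ≤ 1 := by
    have := abs_add_le (β j) (-1); rw [abs_neg, abs_one] at this; linarith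
  have := mul_le_mul_of_nonneg_left a1 (hw j)
  have := mul_le_mul_of_nonneg_left a2 (hw j)
  rw [abs_le]; constructor <;> linarith

/-- A local comparison along coordinate directions forces a nonnegative one-sided derivative. -/
lemma nonneg_of_forall_add_mul_nonneg {a c : ℝ} (h : ∀ s : ℝ, 0 < s → s ≤ 1 → 0 ≤ a + s * c) :
    0 ≤ a := by
  by_contra! ha
  rcases le_or_gt c 0 with hc | hc
  · have := h 1 one_pos le_rfl; linarith
  -- At this step size `s * c ≤ -a / 2`, so the sum would be at most `a / 2 < 0`.
  · have h1 := h (min 1 (-a / (2 * c))) (lt_min one_pos (by apply div_pos <;> linarith))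
      (min_le_left _ _)
    have h2 : min 1 (-a / (2 * c)) * c ≤ -a / (2 * c) * c :=
      mul_le_mul_of_nonneg_right (min_le_right _ _) hc.le
    have h3 : -a / (2 * c) * c = -a / 2 := by field_simp
    linarith

/-- Move one coordinate by `s * t`, divide by `s` and let `s` shrink: the quadratic part is `O(s)`,
and convexity makes the penalty increment at most `s` times the full one. -/
lemma isStationary_of_forall_le [DecidableEq ι] {X : Matrix (Fin n) ι ℝ} {y : Fin n → ℝ} {l2 : ℝ}
    {w β : ι → ℝ} (hw : ∀ j, 0 ≤ w j)
    (hβ : ∀ β', ridgeLoss X y l2 β + ∑ j, w j * |β j|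
      ≤ ridgeLoss X y l2 β' + ∑ j, w j * |β' j|) :
    IsStationary X y l2 w β := by
  intro j t
  refine nonneg_of_forall_add_mul_nonneg
    (c := (∑ i, X i j ^ 2) * t ^ 2 + l2 * t ^ 2) fun s hs hs1 => ?_
  have h1 := hβ (β + Pi.single j (s * t))
  rw [ridgeLoss_add] at h1
  have e1 : ∑ k, score X y l2 β k * (Pi.single j (s * t) : ι → ℝ) k
      = score X y l2 β j * (s * t) := by
    rw [Finset.sum_eq_single j] <;> simp +contextual
  have e2 : ∑ i, (X *ᵥ (Pi.single j (s * t) : ι → ℝ)) i ^ 2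
      = (∑ i, X i j ^ 2) * (s * t) ^ 2 := by
    rw [Finset.sum_mul]
    refine Finset.sum_congr rfl fun i _ => ?_
    rw [Matrix.mulVec_single, ← mul_pow]; simp
  have e3 : ∑ k, (Pi.single j (s * t) : ι → ℝ) k ^ 2 = (s * t) ^ 2 := by
    rw [Finset.sum_eq_single j] <;> simp +contextual
  have e4 : ∑ k, w k * |(β + Pi.single j (s * t) : ι → ℝ) k| - ∑ k, w k * |β k|
      = w j * (|β j + s * t| - |β j|) := by
    rw [← Finset.sum_sub_distrib, Finset.sum_eq_single j]
    · simp; ring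
    · intro k _ hk; simp [hk]
    · simp
  have e5 : |β j + s * t| - |β j| ≤ s * (|β j + t| - |β j|) := by
    have : β j + s * t = (1 - s) * β j + s * (β j + t) := by ring
    rw [this]
    refine (sub_le_sub_right (abs_add_le _ _) _).trans ?_
    rw [abs_mul, abs_mul, abs_of_pos hs, abs_of_nonneg (sub_nonneg.2 hs1)]
    apply le_of_eq; ring
  have e6 := mul_le_mul_of_nonneg_left e5 (hw j)
  rw [e1, e2, e3] at h1
  have h7 : 0 ≤ s * (-2 * score X y l2 β j * t + w j * (|β j + t| - |β j|)
      + s * ((∑ i, X i j ^ 2) * t ^ 2 + l2 * t ^ 2)) := by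
    have : s * (-2 * score X y l2 β j * t + w j * (|β j + t| - |β j|)
      + s * ((∑ i, X i j ^ 2) * t ^ 2 + l2 * t ^ 2)) = - 2 * (score X y l2 β j * (s * t))
      + w j * (s * (|β j + t| - |β j|)) + (∑ i, X i j ^ 2) * (s * t) ^ 2 + l2 * (s * t) ^ 2 := by
      ring
    rw [this]; linarith
  exact nonneg_of_mul_nonneg_right h7 hs

lemma continuous_ridgeLoss (X : Matrix (Fin n) ι ℝ) (y : Fin n → ℝ) (l2 : ℝ) :
    Continuous (ridgeLoss X y l2) := by
  unfold ridgeLoss Matrix.mulVec dotProduct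
  fun_prop

lemma sq_norm_le_sum_sq (β : ι → ℝ) : ‖β‖ ^ 2 ≤ ∑ j, β j ^ 2 := by
  have h0 : 0 ≤ ∑ j, β j ^ 2 := Finset.sum_nonneg fun j _ => sq_nonneg _
  rw [← Real.le_sqrt (norm_nonneg _) h0]
  refine (pi_norm_le_iff_of_nonneg (Real.sqrt_nonneg _)).2 fun j => Real.le_sqrt_of_sq_le ?_
  rw [Real.norm_eq_abs, sq_abs]
  exact Finset.single_le_sum (f := fun j => β j ^ 2) (fun j _ => sq_nonneg _) (Finset.mem_univ j)

/-- Existence of a minimizer, in the form of the stationarity conditions. -/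
theorem exists_isStationary (X : Matrix (Fin n) ι ℝ) (y : Fin n → ℝ) {l2 c : ℝ}
    (hl2 : 0 ≤ l2) (hc : 0 < c) (hX : ∀ v : ι → ℝ, c * ∑ j, v j ^ 2 ≤ ∑ i, (X *ᵥ v) i ^ 2)
    {w : ι → ℝ} (hw : ∀ j, 0 ≤ w j) : ∃ β, IsStationary X y l2 w β := by
  classical
  have hcont : Continuous fun β : ι → ℝ => ridgeLoss X y l2 β + ∑ j, w j * |β j| :=
    (continuous_ridgeLoss X y l2).add (by fun_prop)
  have hlb : ∀ β : ι → ℝ, c / 2 * ‖β‖ ^ 2 - ∑ i, y i ^ 2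
      ≤ ridgeLoss X y l2 β + ∑ j, w j * |β j| := by
    intro β
    have h1 : 0 ≤ ∑ j, w j * |β j| :=
      Finset.sum_nonneg fun j _ => mul_nonneg (hw j) (abs_nonneg _)
    have h2 : 0 ≤ l2 * ∑ j, β j ^ 2 :=
      mul_nonneg hl2 (Finset.sum_nonneg fun j _ => sq_nonneg _)
    -- Coercivity: the difference of the two sides is half of `(2 y - X β)²`, termwise.
    have h3 : (∑ i, (X *ᵥ β) i ^ 2) / 2 - ∑ i, y i ^ 2 ≤ ∑ i, (y i - (X *ᵥ β) i) ^ 2 := by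
      rw [Finset.sum_div, ← Finset.sum_sub_distrib]
      refine Finset.sum_le_sum fun i _ => ?_
      nlinarith [sq_nonneg (2 * y i - (X *ᵥ β) i)]
    have h4 := hX β
    have h5 := mul_le_mul_of_nonneg_left (sq_norm_le_sum_sq β) hc.le
    unfold ridgeLoss
    linarith
  have hlim : Tendsto (fun β : ι → ℝ => ridgeLoss X y l2 β + ∑ j, w j * |β j|)
      (cocompact _) atTop := by
    refine tendsto_atTop_mono hlb (tendsto_atTop_add_const_right _ _ ?_)
    exact ((tendsto_pow_atTop two_ne_zero).comp (tendsto_norm_cocompact_atTop (E := ι → ℝ))).const_mul_atTop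
      (by positivity)
  obtain ⟨β, hβ⟩ := hcont.exists_forall_le hlim
  exact ⟨β, isStationary_of_forall_le hw hβ⟩

lemma penLoss_of_real_weights (X : Matrix (Fin n) ι ℝ) (y : Fin n → ℝ) {l2 l1 : ℝ}
    (hl2 : 0 ≤ l2) (hl1 : 0 ≤ l1) {w : ι → ℝ} (hw : ∀ j, 0 ≤ w j) (β : ι → ℝ) :
    penLoss X y l2 l1 (fun j => ENNReal.ofReal (w j)) β
      = ENNReal.ofReal (ridgeLoss X y l2 β + ∑ j, (l1 * w j) * |β j|) := by
  have h1 : 0 ≤ ridgeLoss X y l2 β := add_nonneg (Finset.sum_nonneg fun _ _ => sq_nonneg _)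
    (mul_nonneg hl2 (Finset.sum_nonneg fun _ _ => sq_nonneg _))
  have h2 : ∀ j, 0 ≤ w j * |β j| := fun j => mul_nonneg (hw j) (abs_nonneg _)
  have e : ∑ j, (l1 * w j) * |β j| = l1 * ∑ j, w j * |β j| := by
    rw [Finset.mul_sum]; exact Finset.sum_congr rfl fun j _ => by ring
  rw [e, ENNReal.ofReal_add h1 (mul_nonneg hl1 (Finset.sum_nonneg fun j _ => h2 j)),
    ENNReal.ofReal_mul hl1, ENNReal.ofReal_sum_of_nonneg fun j _ => h2 j, penLoss, ridgeLoss]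
  simp only [ENNReal.ofReal_mul (hw _)]

lemma ridgeLoss_nonneg (X : Matrix (Fin n) ι ℝ) (y : Fin n → ℝ) {l2 : ℝ} (hl2 : 0 ≤ l2)
    (β : ι → ℝ) : 0 ≤ ridgeLoss X y l2 β :=
  add_nonneg (Finset.sum_nonneg fun _ _ => sq_nonneg _)
    (mul_nonneg hl2 (Finset.sum_nonneg fun _ _ => sq_nonneg _))

/-- A stationary point for finite weights `w` stays the unique minimizer when the weights are
increased, up to `∞`, off its support. -/
theorem penArgmin_eq_singleton {X : Matrix (Fin n) ι ℝ} {y : Fin n → ℝ} {l2 l1 c : ℝ}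
    (hl2 : 0 ≤ l2) (hl1 : 0 ≤ l1) (hc : 0 < c)
    (hX : ∀ v : ι → ℝ, c * ∑ j, v j ^ 2 ≤ ∑ i, (X *ᵥ v) i ^ 2)
    {w : ι → ℝ} (hw : ∀ j, 0 ≤ w j) {W : ι → ℝ≥0∞} (hwW : ∀ j, ENNReal.ofReal (w j) ≤ W j)
    {β : ι → ℝ} (hWβ : ∀ j, β j ≠ 0 → W j = ENNReal.ofReal (w j))
    (hβ : IsStationary X y l2 (fun j => l1 * w j) β) :
    penArgmin X y l2 l1 W = {β} := by
  have hmono : ∀ β', penLoss X y l2 l1 (fun j => ENNReal.ofReal (w j)) β'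
      ≤ penLoss X y l2 l1 W β' := fun β' => by
    unfold penLoss
    gcongr with j
    exact hwW j
  -- The two criteria agree at `β` because off its support the convention `∞ * 0 = 0` hides the
  -- weight. As `W` only raises the criterion elsewhere, minimality and uniqueness carry over.
  have heq : penLoss X y l2 l1 W β = penLoss X y l2 l1 (fun j => ENNReal.ofReal (w j)) β := by
    unfold penLoss
    congr 2
    refine Finset.sum_congr rfl fun j _ => ?_
    by_cases h : β j = 0
    · simp [h]
    · rw [hWβ j h]
  have hsum : ∀ β' : ι → ℝ, 0 ≤ ∑ j, (l1 * w j) * |β' j| := fun β' =>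
    Finset.sum_nonneg fun j _ => mul_nonneg (mul_nonneg hl1 (hw j)) (abs_nonneg _)
  have hmin : ∀ β', penLoss X y l2 l1 W β ≤ penLoss X y l2 l1 W β' := fun β' => by
    refine le_trans ?_ (hmono β')
    rw [heq, penLoss_of_real_weights X y hl2 hl1 hw, penLoss_of_real_weights X y hl2 hl1 hw]
    apply ENNReal.ofReal_le_ofReal
    have h1 := hβ.quadratic_growth β'
    have h2 : 0 ≤ ∑ i, (X *ᵥ (β' - β)) i ^ 2 := Finset.sum_nonneg fun _ _ => sq_nonneg _
    have h3 : 0 ≤ l2 * ∑ j, (β' - β) j ^ 2 :=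
      mul_nonneg hl2 (Finset.sum_nonneg fun _ _ => sq_nonneg _)
    linarith
  refine Set.eq_singleton_iff_unique_mem.2 ⟨hmin, fun β' hβ' => ?_⟩
  have h0 := (hmono β').trans (hβ' β)
  rw [heq, penLoss_of_real_weights X y hl2 hl1 hw, penLoss_of_real_weights X y hl2 hl1 hw,
    ENNReal.ofReal_le_ofReal_iff (add_nonneg (ridgeLoss_nonneg X y hl2 β) (hsum β))] at h0
  have h1 := hβ.quadratic_growth β'
  have h2 := hX (β' - β)
  have h3 : 0 ≤ l2 * ∑ j, (β' - β) j ^ 2 :=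
    mul_nonneg hl2 (Finset.sum_nonneg fun _ _ => sq_nonneg _)
  have h4 : ∑ j, (β' - β) j ^ 2 = 0 := by
    refine le_antisymm ?_ (Finset.sum_nonneg fun _ _ => sq_nonneg _)
    by_contra! h
    have := mul_pos hc h
    linarith
  rw [Finset.sum_eq_zero_iff_of_nonneg fun _ _ => sq_nonneg _] at h4
  funext j
  have := h4 j (Finset.mem_univ j)
  rw [sq_eq_zero_iff, Pi.sub_apply] at this
  linarith

end Deterministic

end AdaEnet

namespace AdaEnet

/-! ### Elastic-net error bound and reduction of the oracle property to inequalities on the errors.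
-/

section Deterministic

variable {n : ℕ} {ι κ : Type*} [Fintype ι] [Fintype κ]

lemma abs_sum_mul_le_sqrt_mul_sqrt (f g : ι → ℝ) :
    |∑ j, f j * g j| ≤ √(∑ j, f j ^ 2) * √(∑ j, g j ^ 2) := by
  refine (Finset.abs_sum_le_sum_abs _ _).trans ?_
  simp only [abs_mul]
  refine (Real.sum_mul_le_sqrt_mul_sqrt _ _ _).trans (le_of_eq ?_)
  simp only [sq_abs]

lemma sum_abs_le_sqrt_card_mul_sqrt (h : ι → ℝ) :
    ∑ j, |h j| ≤ √(Fintype.card ι) * √(∑ j, h j ^ 2) := by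
  have := Real.sum_mul_le_sqrt_mul_sqrt Finset.univ (fun _ : ι => (1 : ℝ)) fun j => |h j|
  simpa using this

lemma score_response (X : Matrix (Fin n) ι ℝ) (βs : ι → ℝ) (ε : ℕ → ℝ) (l2 : ℝ) (j : ι) :
    score X (response X βs ε) l2 βs j = (∑ i : Fin n, X i j * ε i) - l2 * βs j := by
  simp [score, response]

/-- The error bound for the elastic net, before rescaling. -/
theorem mul_sqrt_sum_sq_sub_le {X : Matrix (Fin n) ι ℝ} {βs β : ι → ℝ} {ε : ℕ → ℝ}
    {l2 l1 c : ℝ} (hl2 : 0 ≤ l2) (hl1 : 0 ≤ l1)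
    (hX : ∀ v : ι → ℝ, c * ∑ j, v j ^ 2 ≤ ∑ i, (X *ᵥ v) i ^ 2)
    (hβ : IsStationary X (response X βs ε) l2 (fun _ => l1) β) :
    c * √(∑ j, (β j - βs j) ^ 2) ≤ √(∑ j, (∑ i : Fin n, X i j * ε i) ^ 2)
      + l2 * √(∑ j, βs j ^ 2) + l1 * √(Fintype.card ι) := by
  set h : ι → ℝ := β - βs with hh
  have hβh : βs + h = β := by rw [hh]; abel
  set Q := √(∑ j, h j ^ 2) with hQ
  have hQ2 : Q ^ 2 = ∑ j, h j ^ 2 := Real.sq_sqrt (Finset.sum_nonneg fun _ _ => sq_nonneg _)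
  have hQ0 : 0 ≤ Q := Real.sqrt_nonneg _
  -- Growth at `β` and the exact expansion at `βs` each give one copy of `‖X h‖²`. The resulting
  -- factor 2 matches the one on the score, so the constant `c` is not lost.
  have h1 := hβ.quadratic_growth βs
  have h2 := ridgeLoss_add X (response X βs ε) l2 βs h
  rw [hβh] at h2
  have e1 : βs - β = -h := by rw [hh]; abel
  have e2 : ∑ i, (X *ᵥ (-h)) i ^ 2 = ∑ i, (X *ᵥ h) i ^ 2 := by simp [Matrix.mulVec_neg]
  have e3 : ∑ j, (-h) j ^ 2 = ∑ j, h j ^ 2 := by simp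
  rw [e1, e2, e3] at h1
  have h3 : ∑ j, l1 * |βs j| - ∑ j, l1 * |β j| ≤ l1 * (√(Fintype.card ι) * Q) := by
    rw [← Finset.mul_sum, ← Finset.mul_sum, ← mul_sub, ← Finset.sum_sub_distrib]
    refine mul_le_mul_of_nonneg_left (le_trans ?_ (sum_abs_le_sqrt_card_mul_sqrt h)) hl1
    refine Finset.sum_le_sum fun j _ => (abs_sub_abs_le_abs_sub _ _).trans (le_of_eq ?_)
    rw [abs_sub_comm, hh, Pi.sub_apply]
  have h4 : ∑ j, score X (response X βs ε) l2 βs j * h j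
      ≤ √(∑ j, (∑ i : Fin n, X i j * ε i) ^ 2) * Q + l2 * (√(∑ j, βs j ^ 2) * Q) := by
    have a1 := le_of_abs_le (abs_sum_mul_le_sqrt_mul_sqrt (fun j => ∑ i : Fin n, X i j * ε i) h)
    have a2 := mul_le_mul_of_nonneg_left
      (neg_le_of_abs_le (abs_sum_mul_le_sqrt_mul_sqrt βs h)) hl2
    have a3 : ∑ j, score X (response X βs ε) l2 βs j * h j
        = ∑ j, (∑ i : Fin n, X i j * ε i) * h j - l2 * ∑ j, βs j * h j := by
      rw [Finset.mul_sum, ← Finset.sum_sub_distrib]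
      exact Finset.sum_congr rfl fun j _ => by rw [score_response]; ring
    rw [a3]; linarith
  have h5 := hX h
  have h6 : 0 ≤ l2 * ∑ j, h j ^ 2 := mul_nonneg hl2 (by rw [← hQ2]; positivity)
  have h7 : 0 ≤ l1 * (√(Fintype.card ι) * Q) := by positivity
  have h8 : (c * Q) * Q ≤ (√(∑ j, (∑ i : Fin n, X i j * ε i) ^ 2)
      + l2 * √(∑ j, βs j ^ 2) + l1 * √(Fintype.card ι)) * Q := by
    rw [← hQ2] at h5 h6
    nlinarith
  rcases hQ0.eq_or_lt with h0 | h0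
  · have : √(∑ j, (β j - βs j) ^ 2) = 0 := by rw [h0, hQ]; rfl
    rw [this, mul_zero]
    exact add_nonneg (add_nonneg (Real.sqrt_nonneg _) (mul_nonneg hl2 (Real.sqrt_nonneg _)))
      (mul_nonneg hl1 (Real.sqrt_nonneg _))
  · exact le_of_mul_le_mul_right h8 h0

lemma IsStationary.score_eq_zero {X : Matrix (Fin n) ι ℝ} {y : Fin n → ℝ} {l2 : ℝ}
    {β : ι → ℝ} (hβ : IsStationary X y l2 (fun _ => 0) β) (j : ι) : score X y l2 β j = 0 := by
  have := hβ.abs_score_le (fun _ => le_rfl) j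
  simpa using this

/-- The correlation of a further column `x` with the residual of a penalized fit. Here `d` are
the coefficients of the ridge regression of `x` on the columns of `X`. -/
lemma sum_mul_residual_eq {X : Matrix (Fin n) κ ℝ} {βs v d : κ → ℝ} {ε : ℕ → ℝ} {l2 : ℝ}
    {x : Fin n → ℝ} (hd : IsStationary X x l2 (fun _ => 0) d) :
    ∑ i, x i * (response X βs ε i - (X *ᵥ v) i) = ∑ i : Fin n, (x i - (X *ᵥ d) i) * ε i
      + ∑ k, d k * (l2 * βs k + score X (response X βs ε) l2 v k) := by
  have h1 := sum_score_mul X (response X βs ε) l2 v d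
  -- The normal equations of `d`, tested on `βs - v`, turn the bias `⟨X (βs - v), x - X d⟩` into `l2
  -- * ⟨d, βs - v⟩`.
  have h2 := sum_score_mul X x l2 d (βs - v)
  simp only [hd.score_eq_zero, zero_mul, Finset.sum_const_zero, Matrix.mulVec_sub,
    Pi.sub_apply] at h2
  have h3 : ∑ i, x i * (response X βs ε i - (X *ᵥ v) i) = ∑ i : Fin n, (x i - (X *ᵥ d) i) * ε i
      + ∑ i, ((X *ᵥ βs) i - (X *ᵥ v) i) * (x i - (X *ᵥ d) i)
      + ∑ i, (X *ᵥ d) i * (response X βs ε i - (X *ᵥ v) i) := by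
    rw [← Finset.sum_add_distrib, ← Finset.sum_add_distrib]
    exact Finset.sum_congr rfl fun i _ => by rw [response]; ring
  have h4 : ∑ k, d k * (l2 * βs k + score X (response X βs ε) l2 v k)
      = l2 * ∑ k, d k * (βs k - v k) + l2 * ∑ k, v k * d k
        + ∑ k, score X (response X βs ε) l2 v k * d k := by
    rw [Finset.mul_sum, Finset.mul_sum, ← Finset.sum_add_distrib, ← Finset.sum_add_distrib]
    exact Finset.sum_congr rfl fun i _ => by ring
  linarith

/-- Quadratic growth against the zero vector. It controls both the residual `a_j` and, through the
lower bound on the design, the size of `d`. -/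
lemma ridge_fit_bounds {X : Matrix (Fin n) κ ℝ} {d : κ → ℝ} {l2 : ℝ} {x : Fin n → ℝ}
    (hl2 : 0 ≤ l2) (hd : IsStationary X x l2 (fun _ => 0) d) :
    ∑ i, (x i - (X *ᵥ d) i) ^ 2 + ∑ i, (X *ᵥ d) i ^ 2 ≤ ∑ i, x i ^ 2 := by
  have h := hd.quadratic_growth 0
  have h1 : 0 ≤ l2 * ∑ j, d j ^ 2 := mul_nonneg hl2 (Finset.sum_nonneg fun _ _ => sq_nonneg _)
  simp [ridgeLoss, Matrix.mulVec_neg] at h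
  linarith

/-- The fit `v` enters only through its score, which stationarity bounds; the noise term involves
`d` alone. Cauchy–Schwarz with `‖d‖₂ ≤ √(L / c)` handles the rest. -/
lemma abs_sum_mul_residual_le {X : Matrix (Fin n) κ ℝ} {βs v d : κ → ℝ} {ε : ℕ → ℝ} {l2 c L G : ℝ}
    {x : Fin n → ℝ} (hl2 : 0 ≤ l2) (hc : 0 < c) (hG : 0 ≤ G)
    (hX : ∀ v : κ → ℝ, c * ∑ j, v j ^ 2 ≤ ∑ i, (X *ᵥ v) i ^ 2)
    (hx : ∑ i, x i ^ 2 ≤ L)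
    (hd : IsStationary X x l2 (fun _ => 0) d)
    (hv : ∀ k, |score X (response X βs ε) l2 v k| ≤ G) :
    |∑ i, x i * (response X βs ε i - (X *ᵥ v) i)| ≤ |∑ i : Fin n, (x i - (X *ᵥ d) i) * ε i|
      + √(L / c) * (l2 * √(∑ k, βs k ^ 2) + √(Fintype.card κ) * G) := by
  rw [sum_mul_residual_eq hd]
  refine (abs_add_le _ _).trans (add_le_add_right ?_ _)
  have hdc : √(∑ k, d k ^ 2) ≤ √(L / c) := by
    apply Real.sqrt_le_sqrt
    rw [le_div_iff₀ hc]
    have h1 := ridge_fit_bounds hl2 hd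
    have h2 := hX d
    have h3 : 0 ≤ ∑ i, (x i - (X *ᵥ d) i) ^ 2 := Finset.sum_nonneg fun _ _ => sq_nonneg _
    linarith
  have e : ∑ k, d k * (l2 * βs k + score X (response X βs ε) l2 v k)
      = l2 * ∑ k, d k * βs k + ∑ k, d k * score X (response X βs ε) l2 v k := by
    rw [Finset.mul_sum, ← Finset.sum_add_distrib]
    exact Finset.sum_congr rfl fun k _ => by ring
  have b1 : |l2 * ∑ k, d k * βs k| ≤ √(L / c) * (l2 * √(∑ k, βs k ^ 2)) := by
    rw [abs_mul, abs_of_nonneg hl2]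
    have := mul_le_mul_of_nonneg_left ((abs_sum_mul_le_sqrt_mul_sqrt d βs).trans
      (mul_le_mul_of_nonneg_right hdc (Real.sqrt_nonneg _))) hl2
    linarith
  have b2 : |∑ k, d k * score X (response X βs ε) l2 v k|
      ≤ √(L / c) * (√(Fintype.card κ) * G) := by
    calc |∑ k, d k * score X (response X βs ε) l2 v k|
        ≤ ∑ k, |d k * score X (response X βs ε) l2 v k| := Finset.abs_sum_le_sum_abs _ _
      _ ≤ ∑ k, |d k| * G := Finset.sum_le_sum fun k _ => by
          rw [abs_mul]; exact mul_le_mul_of_nonneg_left (hv k) (abs_nonneg _)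
      _ = (∑ k, |d k|) * G := by rw [Finset.sum_mul]
      _ ≤ (√(Fintype.card κ) * √(L / c)) * G := by
          refine mul_le_mul_of_nonneg_right ((sum_abs_le_sqrt_card_mul_sqrt d).trans ?_) hG
          exact mul_le_mul_of_nonneg_left hdc (Real.sqrt_nonneg _)
      _ = _ := by ring
  rw [e]
  refine (abs_add_le _ _).trans ?_
  linarith

section Active

variable (X : Matrix (Fin n) ι ℝ) (βs : ι → ℝ)

omit [Fintype ι] in
lemma zeroExtend_apply (v : Active βs → ℝ) (j : Active βs) : zeroExtend βs v j.1 = v j :=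
  Subtype.val_injective.extend_apply _ _ _

omit [Fintype ι] in
lemma zeroExtend_of_eq_zero (v : Active βs → ℝ) {j : ι} (hj : βs j = 0) :
    zeroExtend βs v j = 0 := by
  rw [zeroExtend, Function.extend_apply' _ _ _ (by rintro ⟨a, rfl⟩; exact a.2 hj)]; rfl

omit [Fintype ι] in
lemma zeroExtend_smul (c : ℝ) (v : Active βs → ℝ) :
    zeroExtend βs (c • v) = c • zeroExtend βs v := by
  funext j
  by_cases hj : βs j = 0
  · simp [zeroExtend_of_eq_zero _ _ hj]
  · have h1 := zeroExtend_apply βs (c • v) ⟨j, hj⟩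
    have h2 := zeroExtend_apply βs v ⟨j, hj⟩
    simp only at h1 h2
    simp [h1, h2]

lemma sum_mul_zeroExtend (f : ι → ℝ) (v : Active βs → ℝ) :
    ∑ j, f j * zeroExtend βs v j = ∑ j : Active βs, f j.1 * v j := by
  classical
  rw [← Finset.sum_subset (Finset.subset_univ (Finset.univ.filter fun j => βs j ≠ 0))]
  · rw [← Finset.sum_subtype_eq_sum_filter]
    simp only [Finset.subtype_univ]
    refine Finset.sum_congr ?_ fun j _ => by rw [zeroExtend_apply]
    ext; simp
  · intro j _ hj
    rw [zeroExtend_of_eq_zero _ _ (by simpa using hj), mul_zero]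

lemma mulVec_zeroExtend (v : Active βs → ℝ) : X *ᵥ zeroExtend βs v = activeCols X βs *ᵥ v := by
  funext i
  simp only [Matrix.mulVec, dotProduct, sum_mul_zeroExtend]
  rfl

omit [Fintype ι] in
lemma zeroExtend_restrict : zeroExtend βs (fun j => βs j.1) = βs := by
  funext j
  by_cases hj : βs j = 0
  · rw [zeroExtend_of_eq_zero _ _ hj, hj]
  · exact zeroExtend_apply βs _ ⟨j, hj⟩

lemma sum_zeroExtend_sq (v : Active βs → ℝ) :
    ∑ j, zeroExtend βs v j ^ 2 = ∑ j, v j ^ 2 := by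
  simp only [sq, sum_mul_zeroExtend βs (zeroExtend βs v) v, zeroExtend_apply]

lemma response_activeCols (ε : ℕ → ℝ) :
    response (activeCols X βs) (fun j => βs j.1) ε = response X βs ε := by
  unfold response
  rw [← mulVec_zeroExtend, zeroExtend_restrict]

lemma activeCols_lower_bound {c : ℝ}
    (hX : ∀ v : ι → ℝ, c * ∑ j, v j ^ 2 ≤ ∑ i, (X *ᵥ v) i ^ 2) (v : Active βs → ℝ) :
    c * ∑ j, v j ^ 2 ≤ ∑ i, (activeCols X βs *ᵥ v) i ^ 2 := by
  have := hX (zeroExtend βs v)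
  rwa [sum_zeroExtend_sq, mulVec_zeroExtend] at this

lemma score_zeroExtend (y : Fin n → ℝ) (l2 : ℝ) (v : Active βs → ℝ) (j : ι) :
    score X y l2 (zeroExtend βs v) j =
      (∑ i, X i j * (y i - (activeCols X βs *ᵥ v) i)) - l2 * zeroExtend βs v j := by
  rw [score, mulVec_zeroExtend]

end Active

/-- Deterministic sufficient conditions on the errors for the oracle property. The vectors `a j`
are the residuals of the ridge regressions of the columns of `X` on the active ones. -/
theorem exists_oracleSolves_of_bounds (X : Matrix (Fin n) ι ℝ) (βs : ι → ℝ)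
    {l2 l1 l1s γ τ c L : ℝ} (hl2 : 0 ≤ l2) (hl1 : 0 ≤ l1) (hl1s : 0 < l1s) (hγ : 0 < γ)
    (hτ : 0 ≤ τ) (hc : 0 < c)
    (hX : ∀ v : ι → ℝ, c * ∑ j, v j ^ 2 ≤ ∑ i, (X *ᵥ v) i ^ 2)
    (hL : ∀ j, ∑ i, X i j ^ 2 ≤ L) :
    ∃ a : ι → Fin n → ℝ, (∀ j, ∑ i, a j i ^ 2 ≤ L) ∧
      ∀ (ε : ℕ → ℝ) (R G E : ℝ), 0 < R → 0 ≤ G →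
        (1 + l2 / n) * ((√(∑ j, (∑ i : Fin n, X i j * ε i) ^ 2)
          + l2 * √(∑ j, βs j ^ 2) + l1 * √(Fintype.card ι)) / c)
          + l2 / n * √(∑ j, βs j ^ 2) ≤ R →
        (∀ j, βs j ≠ 0 → 2 * R ≤ |βs j|) →
        (∀ j, βs j ≠ 0 → l1s * √(Fintype.card ι) * (|βs j| / 2) ^ (-γ) ≤ G) →
        (∀ j, |∑ i : Fin n, a j i * ε i| ≤ E) →
        2 * (E + √(L / c) * (l2 * √(∑ j, βs j ^ 2) + G)) ≤ l1s * (R + τ) ^ (-γ) →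
        OracleSolves X βs (response X βs ε) l2 l1 l1s γ τ := by
  classical
  have hXA := activeCols_lower_bound X βs hX
  -- These coefficients are fixed before the errors, so the forms `∑ i, a j i * ε i` have
  -- deterministic coefficients.
  choose d hd using fun j => exists_isStationary (activeCols X βs) (fun i => X i j) hl2 hc hXA
    (w := fun _ => 0) (fun _ => le_rfl)
  refine ⟨fun j i => X i j - (activeCols X βs *ᵥ d j) i, fun j => ?_, ?_⟩
  · have h1 := ridge_fit_bounds hl2 (hd j)
    have h2 : 0 ≤ ∑ i, (activeCols X βs *ᵥ d j) i ^ 2 := Finset.sum_nonneg fun _ _ => sq_nonneg _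
    linarith [hL j]
  intro ε R G E hR hG hRbound hsignal hweight hnoise hkkt
  set y := response X βs ε with hy
  -- the elastic net
  obtain ⟨β, hβ⟩ := exists_isStationary X y hl2 hc hX (w := fun _ => l1) fun _ => hl1
  have hs0 : 0 ≤ 1 + l2 / (n : ℝ) := by positivity
  set bE : ι → ℝ := (1 + l2 / (n : ℝ)) • β with hbE
  have herr : ∀ j, |bE j - βs j| ≤ R := by
    intro j
    have h1 : √(∑ j, (β j - βs j) ^ 2) ≤ (√(∑ j, (∑ i : Fin n, X i j * ε i) ^ 2)
          + l2 * √(∑ j, βs j ^ 2) + l1 * √(Fintype.card ι)) / c := by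
      rw [le_div_iff₀ hc, mul_comm]
      exact mul_sqrt_sum_sq_sub_le hl2 hl1 hX hβ
    have h2 : |β j - βs j| ≤ √(∑ j, (β j - βs j) ^ 2) :=
      Real.abs_le_sqrt (Finset.single_le_sum (f := fun j => (β j - βs j) ^ 2)
        (fun _ _ => sq_nonneg _) (Finset.mem_univ j))
    have h3 : |βs j| ≤ √(∑ j, βs j ^ 2) :=
      Real.abs_le_sqrt (Finset.single_le_sum (f := fun j => βs j ^ 2)
        (fun _ _ => sq_nonneg _) (Finset.mem_univ j))
    have e : bE j - βs j = (1 + l2 / (n : ℝ)) * (β j - βs j) + l2 / n * βs j := by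
      rw [hbE, Pi.smul_apply, smul_eq_mul]; ring
    have hn : 0 ≤ l2 / (n : ℝ) := by positivity
    rw [e]
    refine (abs_add_le _ _).trans (le_trans ?_ hRbound)
    rw [abs_mul, abs_mul, abs_of_nonneg hs0, abs_of_nonneg hn]
    exact add_le_add (mul_le_mul_of_nonneg_left (h2.trans h1) hs0)
      (mul_le_mul_of_nonneg_left h3 hn)
  have hbA : ∀ j, βs j ≠ 0 → |βs j| / 2 ≤ |bE j| := by
    intro j hj
    have h1 := hsignal j hj
    have h2 := abs_sub_abs_le_abs_sub (βs j) (bE j)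
    rw [abs_sub_comm] at h2
    linarith [herr j]
  -- the oracle fit
  set w : ι → ℝ := fun j => (|bE j| + τ) ^ (-γ) with hw
  have hw0 : ∀ j, 0 ≤ w j := fun j => Real.rpow_nonneg (by positivity) _
  obtain ⟨v, hv⟩ := exists_isStationary (activeCols X βs) y hl2 hc hXA
    (w := fun j => l1s * w j.1) fun j => mul_nonneg hl1s.le (hw0 _)
  have hwW : ∀ j, βs j ≠ 0 → adaWeight γ τ bE j = ENNReal.ofReal (w j) := by
    intro j hj
    have : 0 < |bE j| := lt_of_lt_of_le (by positivity) (hbA j hj)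
    rw [adaWeight, ENNReal.ofReal_rpow_of_pos (by positivity)]
  have hscore : ∀ k, |score (activeCols X βs) y l2 v k| ≤ l1s * (|βs k.1| / 2) ^ (-γ) := by
    intro k
    refine (hv.abs_score_le (fun j => mul_nonneg hl1s.le (hw0 _)) k).trans ?_
    have h0 : 0 < |βs k.1| / 2 := by have := k.2; positivity
    have h1 : w k.1 ≤ (|βs k.1| / 2) ^ (-γ) :=
      Real.rpow_le_rpow_of_nonpos h0 ((hbA _ k.2).trans (le_add_of_nonneg_right hτ))
        (by linarith)
    have := mul_le_mul_of_nonneg_left h1 hl1s.le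
    have := mul_nonneg hl1s.le (hw0 k.1)
    linarith
  have hres : ∀ j, 2 * |∑ i, X i j * (y i - (activeCols X βs *ᵥ v) i)| ≤ l1s * (R + τ) ^ (-γ) := by
    intro j
    have hcardle : (Fintype.card (Active βs) : ℝ) ≤ Fintype.card ι :=
      Nat.cast_le.2 (Fintype.card_subtype_le _)
    -- The score bound supplied is `G / m` with `m` the root of the active count, so that `m`
    -- cancels. With no active column `m = 0`, and the bound `0` holds vacuously.
    rcases isEmpty_or_nonempty (Active βs) with hA | hA
    · have h1 := abs_sum_mul_residual_le (βs := fun j : Active βs => βs j.1) (ε := ε) (v := v)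
        (G := 0) hl2 hc le_rfl hXA (hL j) (hd j) (fun k => hA.elim k)
      rw [response_activeCols, mul_zero, add_zero] at h1
      refine le_trans ?_ hkkt
      have h2 : √(∑ k : Active βs, βs k.1 ^ 2) ≤ √(∑ j, βs j ^ 2) := by simp
      have h3 := hnoise j
      have h4 := mul_le_mul_of_nonneg_left h2 (mul_nonneg (Real.sqrt_nonneg (L / c)) hl2)
      have h5 := mul_nonneg (Real.sqrt_nonneg (L / c)) hG
      linarith
    · set m := √(Fintype.card (Active βs) : ℝ) with hm
      have hm0 : 0 < m := Real.sqrt_pos.2 (Nat.cast_pos.2 Fintype.card_pos)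
      have h1 := abs_sum_mul_residual_le (βs := fun j : Active βs => βs j.1) (ε := ε) (v := v)
        (G := G / m) hl2 hc (by positivity) hXA (hL j) (hd j) (fun k => by
          rw [response_activeCols]
          refine (hscore k).trans ?_
          rw [le_div_iff₀ hm0]
          refine le_trans ?_ (hweight k.1 k.2)
          have : m ≤ √(Fintype.card ι : ℝ) := Real.sqrt_le_sqrt hcardle
          have h0 : 0 ≤ l1s * (|βs k.1| / 2) ^ (-γ) := by positivity
          have := mul_le_mul_of_nonneg_left this h0
          linarith)
      rw [response_activeCols, ← hm, mul_div_cancel₀ _ hm0.ne'] at h1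
      have h2 : ∑ k : Active βs, βs k.1 ^ 2 = ∑ j, βs j ^ 2 := by
        rw [← sum_zeroExtend_sq, zeroExtend_restrict]
      rw [h2] at h1
      have h3 := hnoise j
      linarith
  refine ⟨bE, v, ?_, ?_, ?_⟩
  · have := penArgmin_eq_singleton (W := fun _ => 1) hl2 hl1 hc hX (w := fun _ => 1)
      (fun _ => zero_le_one) (fun _ => by simp) (fun _ _ => by simp) (β := β)
      (by simpa using hβ)
    rw [enet, weightedEnet, this, Set.image_singleton]
  · exact penArgmin_eq_singleton hl2 hl1s.le hc hXA (w := fun j => w j.1) (fun j => hw0 _)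
      (fun j => (hwW j.1 j.2).ge) (fun j _ => hwW j.1 j.2) hv
  · set r : ι → ℝ := fun j => ∑ i, X i j * (y i - (activeCols X βs *ᵥ v) i) with hr
    have hstat : penArgmin X y l2 l1s (adaWeight γ τ bE) = {zeroExtend βs v} := by
      -- True inactive weights may be infinite. They are replaced by the smallest finite weights `2
      -- * |r j| / l1s` for which KKT holds at zero; the true ones dominate them.
      refine penArgmin_eq_singleton hl2 hl1s.le hc hX
        (w := fun j => if βs j = 0 then 2 * |r j| / l1s else w j) ?_ ?_ ?_ ?_
      · intro j; split_ifs
        · positivity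
        · exact hw0 j
      · intro j; split_ifs with hj
        · have h1 : 2 * |r j| / l1s ≤ (R + τ) ^ (-γ) := by
            rw [div_le_iff₀ hl1s, mul_comm _ l1s]; exact hres j
          refine (ENNReal.ofReal_le_ofReal h1).trans ?_
          rw [← ENNReal.ofReal_rpow_of_pos (by positivity), adaWeight]
          have h2 := herr j
          rw [hj, sub_zero] at h2
          -- Inverses in `[0, ∞]` also cover `bE j = 0` with `τ = 0`, where the weight is `∞`.
          rw [ENNReal.rpow_neg, ENNReal.rpow_neg, ENNReal.inv_le_inv]
          exact ENNReal.rpow_le_rpow (ENNReal.ofReal_le_ofReal (by linarith)) hγ.le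
        · exact (hwW j hj).ge
      · intro j hj
        have hj' : βs j ≠ 0 := fun h => hj (zeroExtend_of_eq_zero _ _ h)
        rw [if_neg hj', hwW j hj']
      · intro j t
        rw [score_zeroExtend]
        change 0 ≤ -2 * (r j - l2 * zeroExtend βs v j) * t
          + (l1s * if βs j = 0 then 2 * |r j| / l1s else w j)
            * (|zeroExtend βs v j + t| - |zeroExtend βs v j|)
        by_cases hj : βs j = 0
        · rw [if_pos hj, zeroExtend_of_eq_zero _ _ hj, mul_div_cancel₀ _ hl1s.ne']
          simp only [mul_zero, sub_zero, zero_add, abs_zero]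
          have := le_abs_self (r j * t)
          rw [abs_mul] at this
          linarith
        · rw [if_neg hj]
          have h1 := hv ⟨j, hj⟩ t
          have h2 := zeroExtend_apply βs v ⟨j, hj⟩
          simp only at h2
          rw [h2]
          exact h1
    rw [weightedEnet, hstat, Set.image_singleton, zeroExtend_smul]

end Deterministic

end AdaEnet

namespace AdaEnet

/-! ### Moment and tail bounds for linear forms in the errors. -/

section Probability

variable {Ω : Type*} [MeasurableSpace Ω] {P : Measure Ω} [IsProbabilityMeasure P]
variable {ι : Type*} [Fintype ι] {n : ℕ}

omit [IsProbabilityMeasure P] in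
lemma memLp_linear_form {ξ : ℕ → Ω → ℝ} (hL2 : ∀ i, MemLp (ξ i) 2 P) (a : Fin n → ℝ) :
    MemLp (fun ω => ∑ i, a i * ξ i ω) 2 P :=
  memLp_finsetSum _ fun i _ => (hL2 i).const_mul (a i)

lemma integral_sq_linear_form_le {ξ : ℕ → Ω → ℝ} {V : ℝ} (hindep : iIndepFun ξ P)
    (hL2 : ∀ i, MemLp (ξ i) 2 P) (hmean : ∀ i, ∫ ω, ξ i ω ∂P = 0)
    (hV : ∀ i, Var[ξ i; P] ≤ V) (a : Fin n → ℝ) :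
    ∫ ω, (∑ i, a i * ξ i ω) ^ 2 ∂P ≤ V * ∑ i, a i ^ 2 := by
  have hL2' := memLp_linear_form hL2 a
  have hmem : ∀ i : Fin n, MemLp (fun ω => a i * ξ i ω) 2 P := fun i => (hL2 i).const_mul _
  have h0 : ∫ ω, ∑ i, a i * ξ i ω ∂P = 0 := by
    rw [integral_finsetSum _ fun i _ => (hmem i).integrable one_le_two]
    exact Finset.sum_eq_zero fun i _ => by rw [integral_const_mul, hmean, mul_zero]
  rw [← variance_of_integral_eq_zero hL2'.aemeasurable h0]
  have e : (fun ω => ∑ i, a i * ξ i ω) = ∑ i : Fin n, fun ω => a i * ξ i ω := by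
    ext ω; simp
  rw [e, IndepFun.variance_sum (fun i _ => hmem i) fun i _ j _ hij => ?_, Finset.mul_sum]
  · refine Finset.sum_le_sum fun i _ => ?_
    rw [variance_const_mul, mul_comm V]
    exact mul_le_mul_of_nonneg_left (hV i) (sq_nonneg _)
  · exact (hindep.indepFun (Fin.val_injective.ne hij)).comp
      (measurable_const_mul (a i)) (measurable_const_mul (a j))

/-- Markov's inequality for a sum of squared linear forms in independent variables. -/
lemma measureReal_le_sum_sq_linear_form {ξ : ℕ → Ω → ℝ} {V L t : ℝ} (hindep : iIndepFun ξ P)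
    (hL2 : ∀ i, MemLp (ξ i) 2 P) (hmean : ∀ i, ∫ ω, ξ i ω ∂P = 0)
    (hV : ∀ i, Var[ξ i; P] ≤ V) (hV0 : 0 ≤ V) {a : ι → Fin n → ℝ} (ha : ∀ j, ∑ i, a j i ^ 2 ≤ L)
    (ht : 0 < t) :
    P.real {ω | t ≤ ∑ j, (∑ i, a j i * ξ i ω) ^ 2} ≤ Fintype.card ι * (V * L) / t := by
  rw [le_div_iff₀ ht, mul_comm]
  have hint : ∀ j, Integrable (fun ω => (∑ i, a j i * ξ i ω) ^ 2) P := fun j =>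
    (memLp_linear_form hL2 (a j)).integrable_sq
  refine (mul_meas_ge_le_integral_of_nonneg
    (ae_of_all _ fun ω => Finset.sum_nonneg fun j _ => sq_nonneg _)
    (integrable_finsetSum _ fun j _ => hint j) t).trans ?_
  rw [integral_finsetSum _ fun j _ => hint j]
  calc ∑ j, ∫ ω, (∑ i, a j i * ξ i ω) ^ 2 ∂P ≤ ∑ _j : ι, V * L :=
        Finset.sum_le_sum fun j _ =>
          (integral_sq_linear_form_le hindep hL2 hmean hV (a j)).trans
            (mul_le_mul_of_nonneg_left (ha j) hV0)
    _ = _ := by simp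

/-- The maximum is at most the ℓ₂ norm, so Markov for the sum of squares acts as Chebyshev with a
union bound. -/
lemma measureReal_exists_le_abs_linear_form {ξ : ℕ → Ω → ℝ} {V L s : ℝ} (hindep : iIndepFun ξ P)
    (hL2 : ∀ i, MemLp (ξ i) 2 P) (hmean : ∀ i, ∫ ω, ξ i ω ∂P = 0)
    (hV : ∀ i, Var[ξ i; P] ≤ V) (hV0 : 0 ≤ V) {a : ι → Fin n → ℝ} (ha : ∀ j, ∑ i, a j i ^ 2 ≤ L)
    (hs : 0 < s) :
    P.real {ω | ∃ j, s ≤ |∑ i, a j i * ξ i ω|} ≤ Fintype.card ι * (V * L) / s ^ 2 := by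
  refine le_trans (measureReal_mono ?_)
    (measureReal_le_sum_sq_linear_form hindep hL2 hmean hV hV0 ha (pow_pos hs 2))
  rintro ω ⟨j, hj⟩
  have h1 : s ^ 2 ≤ (∑ i, a j i * ξ i ω) ^ 2 := by
    rw [← sq_abs (∑ i, a j i * ξ i ω)]; exact pow_le_pow_left₀ hs.le hj 2
  exact h1.trans (Finset.single_le_sum (f := fun j => (∑ i, a j i * ξ i ω) ^ 2)
    (fun _ _ => sq_nonneg _) (Finset.mem_univ j))

omit [IsProbabilityMeasure P] in
lemma measureReal_exists_le_card_mul {s : ι → Set Ω} {q : ℝ} (h : ∀ j, P.real (s j) ≤ q) :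
    P.real {ω | ∃ j, ω ∈ s j} ≤ Fintype.card ι * q := by
  have : {ω | ∃ j, ω ∈ s j} = ⋃ j, s j := by ext; simp
  rw [this]
  refine (measureReal_iUnion_fintype_le _).trans ((Finset.sum_le_sum fun j _ => h j).trans ?_)
  simp

/-- Hoeffding's inequality, uniformly over finitely many linear forms. -/
lemma measureReal_exists_le_abs_linear_form_of_bounded {ξ : ℕ → Ω → ℝ} {T L s : ℝ}
    (hindep : iIndepFun ξ P) (hmeas : ∀ i, AEMeasurable (ξ i) P)
    (hT : ∀ i ω, |ξ i ω| ≤ T) {a : ι → Fin n → ℝ} (ha : ∀ j, ∑ i, a j i ^ 2 ≤ L)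
    (hL : 0 ≤ L) (hs : 0 ≤ s) :
    P.real {ω | ∃ j, s ≤ |∑ i, a j i * (ξ i ω - ∫ ω', ξ i ω' ∂P)|}
      ≤ Fintype.card ι * (2 * Real.exp (-s ^ 2 / (2 * (L * T ^ 2)))) := by
  have hsub : ∀ b : Fin n → ℝ, ∑ i, b i ^ 2 ≤ L →
      P.real {ω | s ≤ ∑ i, b i * (ξ i ω - ∫ ω', ξ i ω' ∂P)}
        ≤ Real.exp (-s ^ 2 / (2 * (L * T ^ 2))) := by
    intro b hb
    have h1 : ∀ i : Fin n, HasSubgaussianMGF (fun ω => b i * (ξ i ω - ∫ ω', ξ i ω' ∂P))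
        ((b i ^ 2).toNNReal * (‖T - -T‖₊ / 2) ^ 2) P := fun i => by
      rw [Real.toNNReal_of_nonneg (sq_nonneg _)]
      exact (hasSubgaussianMGF_of_mem_Icc (hmeas i)
        (ae_of_all _ fun ω => Set.mem_Icc.2 (abs_le.1 (hT i ω)))).const_mul (b i)
    have h2 : iIndepFun (fun (i : Fin n) ω => b i * (ξ i ω - ∫ ω', ξ i ω' ∂P)) P :=
      (hindep.precomp Fin.val_injective).comp (fun i x => b i * (x - ∫ ω', ξ i ω' ∂P))
        fun i => by fun_prop
    have h3 := HasSubgaussianMGF.sum_of_iIndepFun h2 (s := Finset.univ) fun i _ => h1 i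
    set C : NNReal := ∑ i : Fin n, ((b i ^ 2).toNNReal * (‖T - -T‖₊ / 2) ^ 2) with hC
    have hCle : (C : ℝ) ≤ L * T ^ 2 := by
      have e : (C : ℝ) = (∑ i, b i ^ 2) * T ^ 2 := by
        rw [hC, NNReal.coe_sum, Finset.sum_mul]
        refine Finset.sum_congr rfl fun i _ => ?_
        have : ‖T - -T‖ / 2 = |T| := by
          rw [sub_neg_eq_add, ← two_mul, norm_mul, Real.norm_eq_abs, Real.norm_eq_abs]; norm_num
        simp only [NNReal.coe_mul, NNReal.coe_pow, NNReal.coe_div, coe_nnnorm,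
          NNReal.coe_ofNat, Real.coe_toNNReal _ (sq_nonneg (b i))]
        rw [this, sq_abs]
      rw [e]
      exact mul_le_mul_of_nonneg_right hb (sq_nonneg _)
    -- The interval `[-T, T]` gives variance proxy `T²` per variable; the proxy of the sum is raised
    -- to `L * T ^ 2`, common to all forms.
    have h4 : HasSubgaussianMGF (fun ω => ∑ i, b i * (ξ i ω - ∫ ω', ξ i ω' ∂P))
        ⟨L * T ^ 2, mul_nonneg hL (sq_nonneg _)⟩ P :=
      ⟨h3.integrable_exp_mul, fun t => (h3.mgf_le t).trans (Real.exp_le_exp.2 (by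
        have := mul_le_mul_of_nonneg_right hCle (sq_nonneg t)
        change (C : ℝ) * t ^ 2 / 2 ≤ L * T ^ 2 * t ^ 2 / 2
        linarith))⟩
    exact h4.measure_ge_le hs
  refine measureReal_exists_le_card_mul (s := fun j =>
    {ω | s ≤ |∑ i, a j i * (ξ i ω - ∫ ω', ξ i ω' ∂P)|}) fun j => ?_
  have h1 := hsub (a j) (ha j)
  have h2 := hsub (fun i => -a j i) (by simpa using ha j)
  have h3 : {ω | s ≤ |∑ i, a j i * (ξ i ω - ∫ ω', ξ i ω' ∂P)|} ⊆
      {ω | s ≤ ∑ i, a j i * (ξ i ω - ∫ ω', ξ i ω' ∂P)}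
        ∪ {ω | s ≤ ∑ i, -a j i * (ξ i ω - ∫ ω', ξ i ω' ∂P)} := by
    intro ω hω
    rcases le_abs.1 (show s ≤ |_| from hω) with h | h
    · exact Or.inl h
    · refine Or.inr ?_
      simpa only [neg_mul, Finset.sum_neg_distrib, Set.mem_ofPred_eq] using h
  have := (measureReal_mono (μ := P) h3).trans (measureReal_union_le _ _)
  linarith

/-- Truncation at level `T`. -/
noncomputable def truncate (T x : ℝ) : ℝ := if |x| ≤ T then x else 0

lemma measurable_truncate (T : ℝ) : Measurable (truncate T) :=
  Measurable.ite (measurableSet_le (by fun_prop) measurable_const) measurable_id measurable_const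

lemma abs_truncate_le {T : ℝ} (hT : 0 ≤ T) (x : ℝ) : |truncate T x| ≤ T := by
  unfold truncate; split_ifs with h
  · exact h
  · simpa using hT

/-- A nonzero remainder means `|x| > T`, where `(|x| / T) ^ δ ≥ 1`. Hence the tail part has variance
of order `T ^ (-δ)`. -/
lemma sq_sub_truncate_le {T δ : ℝ} (hT : 0 < T) (hδ : 0 < δ) (x : ℝ) :
    (x - truncate T x) ^ 2 ≤ |x| ^ (2 + δ) * T ^ (-δ) := by
  unfold truncate; split_ifs with h
  · rw [sub_self, zero_pow two_ne_zero]; positivity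
  · push Not at h
    have hx : 0 < |x| := hT.trans h
    have e : x ^ 2 = |x| ^ (2 + δ) * |x| ^ (-δ) := by
      rw [← Real.rpow_add hx, add_neg_cancel_right, Real.rpow_two, sq_abs]
    rw [sub_zero, e]
    exact mul_le_mul_of_nonneg_left (Real.rpow_le_rpow_of_nonpos hT h.le (by linarith))
      (by positivity)

/-- A tail bound for the maximum of finitely many linear forms in i.i.d. errors with a moment of
order `2 + δ`, by truncation at level `T`. -/
theorem measureReal_exists_le_abs_linear_form_of_moment {ε : ℕ → Ω → ℝ} {δ T L s : ℝ}
    (hindep : iIndepFun ε P) (hident : ∀ i, IdentDistrib (ε i) (ε 0) P P)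
    (hL2 : MemLp (ε 0) 2 P) (hmean : ∫ ω, ε 0 ω ∂P = 0) (hδ : 0 < δ)
    (hmom : Integrable (fun ω => |ε 0 ω| ^ (2 + δ)) P)
    {a : ι → Fin n → ℝ} (ha : ∀ j, ∑ i, a j i ^ 2 ≤ L) (hL : 0 ≤ L) (hT : 0 < T) (hs : 0 < s) :
    P.real {ω | ∃ j, s ≤ |∑ i, a j i * ε i ω|} ≤
      Fintype.card ι * (2 * Real.exp (-(s / 2) ^ 2 / (2 * (L * T ^ 2))))
      + Fintype.card ι * ((∫ ω, |ε 0 ω| ^ (2 + δ) ∂P) * T ^ (-δ) * L) / (s / 2) ^ 2 := by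
  have hm := measurable_truncate T
  set ξ : ℕ → Ω → ℝ := fun i ω => truncate T (ε i ω) with hξ
  set m := ∫ ω, ξ 0 ω ∂P with hmdef
  have hid2 : ∀ i, IdentDistrib (ξ i) (ξ 0) P P := fun i => (hident i).comp hm
  have hξm : ∀ i, AEMeasurable (ξ i) P := fun i => (hid2 i).aemeasurable_fst
  have hξi : ∀ i, ∫ ω, ξ i ω ∂P = m := fun i => (hid2 i).integral_eq
  have hξL2 : MemLp (ξ 0) 2 P := MemLp.of_bound (hξm 0).aestronglyMeasurable T
    (ae_of_all _ fun ω => abs_truncate_le hT.le _)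
  -- The mean `m` of the truncated error is moved into the remainder, so both summands are centred:
  -- Hoeffding serves for the bounded one, Chebyshev for the other.
  set g : ℝ → ℝ := fun x => x - (truncate T x - m) with hg
  have hgm : Measurable g := measurable_id.sub (hm.sub_const m)
  set ζ : ℕ → Ω → ℝ := fun i ω => g (ε i ω) with hζ
  have hid3 : ∀ i, IdentDistrib (ζ i) (ζ 0) P P := fun i => (hident i).comp hgm
  have hζL2 : MemLp (ζ 0) 2 P := hL2.sub (hξL2.sub (memLp_const m))
  have hζmean : ∫ ω, ζ 0 ω ∂P = 0 := by
    have h1 := hL2.integrable one_le_two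
    have h2 := hξL2.integrable one_le_two
    have h3 : Integrable (fun ω => ξ 0 ω - m) P := h2.sub (integrable_const m)
    change ∫ ω, (ε 0 ω - (ξ 0 ω - m)) ∂P = 0
    rw [integral_sub h1 h3, integral_sub h2 (integrable_const m), hmean]
    simp [hmdef]
  have hζvar : Var[ζ 0; P] ≤ (∫ ω, |ε 0 ω| ^ (2 + δ) ∂P) * T ^ (-δ) := by
    have e : ζ 0 = fun ω => (ε 0 ω - ξ 0 ω) + m := by
      funext ω; simp only [hζ, hg, hξ]; ring
    have hd : MemLp (fun ω => ε 0 ω - ξ 0 ω) 2 P := hL2.sub hξL2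
    rw [e, variance_add_const hd.1]
    refine (variance_le_expectation_sq hd.1).trans ?_
    rw [← integral_mul_const]
    refine integral_mono hd.integrable_sq (hmom.mul_const _) fun ω => ?_
    exact sq_sub_truncate_le hT hδ _
  have b1 := measureReal_exists_le_abs_linear_form_of_bounded (ι := ι) (s := s / 2)
    (ξ := ξ) (hindep.comp (fun _ => truncate T) fun _ => hm) hξm
    (fun i ω => abs_truncate_le hT.le _) ha hL (by positivity)
  have b2 := measureReal_exists_le_abs_linear_form (ι := ι) (s := s / 2) (ξ := ζ)
    (hindep.comp (fun _ => g) fun _ => hgm) (fun i => (hid3 i).memLp_iff.2 hζL2)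
    (fun i => (hid3 i).integral_eq.trans hζmean) (fun i => (hid3 i).variance_eq.le.trans hζvar)
    ((variance_nonneg _ _).trans hζvar) ha (by positivity)
  refine le_trans ((measureReal_mono ?_).trans (measureReal_union_le _ _)) (add_le_add b1 b2)
  rintro ω ⟨j, hj⟩
  have e : ∑ i, a j i * ε i ω = ∑ i : Fin n, a j i * (ξ i ω - ∫ ω', ξ i ω' ∂P)
      + ∑ i : Fin n, a j i * ζ i ω := by
    rw [← Finset.sum_add_distrib]
    refine Finset.sum_congr rfl fun i _ => ?_
    rw [hξi]; simp only [hζ, hg, hξ]; ring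
  rw [e] at hj
  have h := hj.trans (abs_add_le _ _)
  by_contra hc
  simp only [Set.mem_union, Set.mem_ofPred_eq, not_or, not_exists, not_le] at hc
  linarith [hc.1 j, hc.2 j]

end Probability

end AdaEnet

namespace AdaEnet

/-! ### From eigenvalue bounds to quadratic form bounds. -/

section Spectrum

variable {ι : Type*} [Fintype ι] [DecidableEq ι]

/-- Subtracting `b` times the identity shifts the spectrum by `b`, which leaves a positive
semidefinite matrix. -/
lemma mul_dotProduct_self_le_of_spectrum {A : Matrix ι ι ℝ} (hA : A.IsHermitian) {b : ℝ}
    (h : ∀ x ∈ spectrum ℝ A, b ≤ x) (v : ι → ℝ) : b * (v ⬝ᵥ v) ≤ v ⬝ᵥ (A *ᵥ v) := by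
  have hpos : (A - algebraMap ℝ (Matrix ι ι ℝ) b).PosSemidef := by
    rw [Matrix.posSemidef_iff_isHermitian_and_spectrum_nonneg]
    refine ⟨hA.sub ?_, ?_⟩
    · rw [Matrix.algebraMap_eq_diagonal]
      exact Matrix.isHermitian_diagonal _
    · rw [← spectrum.sub_singleton_eq]
      rintro _ ⟨x, hx, _, rfl, rfl⟩
      exact sub_nonneg.2 (h x hx)
  have h1 := hpos.dotProduct_mulVec_nonneg v
  rw [star_trivial, Matrix.sub_mulVec, dotProduct_sub, Matrix.algebraMap_eq_diagonal] at h1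
  have h2 : Matrix.diagonal (algebraMap ℝ (ι → ℝ) b) *ᵥ v = b • v := by
    ext i; simp [Matrix.mulVec_diagonal]
  rw [h2, dotProduct_smul, smul_eq_mul] at h1
  linarith

lemma dotProduct_le_mul_of_spectrum {A : Matrix ι ι ℝ} (hA : A.IsHermitian) {B : ℝ}
    (h : ∀ x ∈ spectrum ℝ A, x ≤ B) (v : ι → ℝ) : v ⬝ᵥ (A *ᵥ v) ≤ B * (v ⬝ᵥ v) := by
  have h1 := mul_dotProduct_self_le_of_spectrum hA.neg (b := -B) (fun x hx => by
    rw [← spectrum.neg_eq] at hx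
    linarith [h _ (Set.mem_neg.1 hx)]) v
  rw [Matrix.neg_mulVec, dotProduct_neg] at h1
  linarith

lemma design_bounds_of_spectrum {n : ℕ} (hn : 0 < n) {X : Matrix (Fin n) ι ℝ} {b B : ℝ}
    (h : spectrum ℝ ((1 / (n : ℝ)) • (Xᵀ * X)) ⊆ Set.Icc b B) (v : ι → ℝ) :
    n * b * ∑ j, v j ^ 2 ≤ ∑ i, (X *ᵥ v) i ^ 2 ∧ ∑ i, (X *ᵥ v) i ^ 2 ≤ n * B * ∑ j, v j ^ 2 := by
  have hn' : (0 : ℝ) < n := Nat.cast_pos.2 hn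
  have hA : ((1 / (n : ℝ)) • (Xᵀ * X)).IsHermitian := by
    rw [Matrix.IsHermitian, Matrix.conjTranspose_eq_transpose_of_trivial, Matrix.transpose_smul,
      Matrix.transpose_mul, Matrix.transpose_transpose]
  have e1 : v ⬝ᵥ (((1 / (n : ℝ)) • (Xᵀ * X)) *ᵥ v) = (∑ i, (X *ᵥ v) i ^ 2) / n := by
    rw [Matrix.smul_mulVec, dotProduct_smul, ← Matrix.mulVec_mulVec, Matrix.dotProduct_mulVec,
      Matrix.vecMul_transpose, smul_eq_mul, one_div, inv_mul_eq_div, dotProduct]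
    simp only [sq]
  have e2 : v ⬝ᵥ v = ∑ j, v j ^ 2 := by simp only [dotProduct, sq]
  have h1 := mul_dotProduct_self_le_of_spectrum hA (fun x hx => (h hx).1) v
  have h2 := dotProduct_le_mul_of_spectrum hA (fun x hx => (h hx).2) v
  rw [e1, e2] at h1 h2
  rw [le_div_iff₀ hn'] at h1
  rw [div_le_iff₀ hn'] at h2
  constructor <;> linarith

lemma sum_sq_col_le_of_spectrum {n : ℕ} (hn : 0 < n) {X : Matrix (Fin n) ι ℝ} {b B : ℝ}
    (h : spectrum ℝ ((1 / (n : ℝ)) • (Xᵀ * X)) ⊆ Set.Icc b B) (j : ι) :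
    ∑ i, X i j ^ 2 ≤ n * B := by
  have := (design_bounds_of_spectrum hn h (Pi.single j 1)).2
  have e : ∑ k, (Pi.single j 1 : ι → ℝ) k ^ 2 = 1 := by
    rw [Finset.sum_eq_single j] <;> simp +contextual
  rw [e, mul_one] at this
  simpa [Matrix.mulVec_single] using this

end Spectrum

/-! ### Failure probability at a fixed sample size. -/

section FixedSampleSize

variable {Ω : Type*} [MeasurableSpace Ω] {P : Measure Ω} [IsProbabilityMeasure P]

/-- A nonasymptotic bound on the probability that the oracle property fails. The constant `K`
controls the `ℓ₂` norm of the scores, the constant `D` their maximum after projection. -/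
theorem measure_not_oracleSolves_le {n p : ℕ} (hn : 0 < n) (hp : 0 < p)
    {X : Matrix (Fin n) (Fin p) ℝ} {βs : Fin p → ℝ} {ε : ℕ → Ω → ℝ} {V : ℝ}
    (hindep : iIndepFun ε P) (hL2 : ∀ i, MemLp (ε i) 2 P) (hmean : ∀ i, ∫ ω, ε i ω ∂P = 0)
    (hV : ∀ i, Var[ε i; P] ≤ V) (hV0 : 0 ≤ V)
    {l2 l1 l1s γ τ b B K D q : ℝ} (hl2 : 0 ≤ l2) (hl1 : 0 ≤ l1) (hl1s : 0 < l1s) (hγ : 0 < γ)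
    (hτ : 0 ≤ τ) (hτn : τ ≤ 1 / n) (hb : 0 < b) (hK : 0 < K) (hD : 1 ≤ D)
    (hX : spectrum ℝ ((1 / (n : ℝ)) • (Xᵀ * X)) ⊆ Set.Icc b B)
    (hl2n : l2 / n ≤ 1) (hridge : l2 * √(∑ j, βs j ^ 2) ≤ √n) (hl1n : l1 ≤ √n)
    (hsignal : ∀ j, βs j ≠ 0 → 2 * ((2 * (K + 2) / b + 1) * √(p / n)) ≤ |βs j|)
    (hweight : ∀ j, βs j ≠ 0 → 2 ^ γ * (l1s * √p) ≤ √n * |βs j| ^ γ)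
    (hkkt : 2 * (1 + 2 * √(B / b)) * (2 * (K + 2) / b + 2) ^ γ * D * √n * √(p / n) ^ γ ≤ l1s)
    (hnoise : ∀ a : Fin p → Fin n → ℝ, (∀ j, ∑ i, a j i ^ 2 ≤ n * B) →
      P.real {ω | ∃ j, D * √n ≤ |∑ i, a j i * ε i ω|} ≤ q) :
    P {ω | ¬ OracleSolves X βs (response X βs (fun i => ε i ω)) l2 l1 l1s γ τ}
      ≤ ENNReal.ofReal (V * B / K ^ 2 + q) := by
  have hn' : (0 : ℝ) < n := Nat.cast_pos.2 hn
  have hp' : (0 : ℝ) < p := Nat.cast_pos.2 hp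
  have hp1 : (1 : ℝ) ≤ p := Nat.one_le_cast.2 hp
  have hn1 : (1 : ℝ) ≤ n := Nat.one_le_cast.2 hn
  set ρ := √((p : ℝ) / n) with hρ
  have hρ0 : 0 < ρ := Real.sqrt_pos.2 (by positivity)
  have hsn : 0 < √(n : ℝ) := Real.sqrt_pos.2 hn'
  have hsp1 : 1 ≤ √(p : ℝ) := Real.one_le_sqrt.2 hp1
  have hnn : √(n : ℝ) * √n = n := Real.mul_self_sqrt hn'.le
  have hsnp : √(n : ℝ) * √p = n * ρ := by
    rw [hρ, Real.sqrt_div hp'.le, mul_div_assoc', eq_div_iff hsn.ne']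
    linear_combination √(p : ℝ) * hnn
  have hsnle : √(n : ℝ) ≤ n * ρ := by
    rw [← hsnp]; exact le_mul_of_one_le_right hsn.le hsp1
  obtain ⟨a, haL, ha⟩ := exists_oracleSolves_of_bounds X βs (c := n * b) (L := n * B) hl2 hl1 hl1s
    hγ hτ (by positivity) (fun v => (design_bounds_of_spectrum hn hX v).1)
    (sum_sq_col_le_of_spectrum hn hX)
  -- The threshold `K² n p` makes the Markov bound `V * B / K ^ 2`, free of `n` and `p`.
  have hS := measureReal_le_sum_sq_linear_form (a := fun j i => X i j) (t := K ^ 2 * (n * p))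
    hindep hL2 hmean hV hV0 (sum_sq_col_le_of_spectrum hn hX) (by positivity)
  have e1 : (Fintype.card (Fin p) : ℝ) * (V * (n * B)) / (K ^ 2 * (n * p)) = V * B / K ^ 2 := by
    rw [Fintype.card_fin]; field_simp
  rw [e1] at hS
  have hN := hnoise a haL
  refine le_trans ?_ (ENNReal.ofReal_le_ofReal (add_le_add hS hN))
  refine le_trans ?_ (ENNReal.ofReal_le_ofReal (measureReal_union_le _ _))
  rw [ofReal_measureReal]
  refine measure_mono fun ω hω => ?_
  by_contra hc
  simp only [Set.mem_union, Set.mem_ofPred_eq, not_or, not_exists, not_le] at hc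
  obtain ⟨hc1, hc2⟩ := hc
  -- In `R`, `K + 2` collects the score, the ridge bias and the ℓ₁ penalty, each in units of `n ρ`;
  -- the factor 2 bounds `1 + l2 / n`, and the final 1 is the bias of rescaling.
  refine hω (ha (fun i => ε i ω) ((2 * (K + 2) / b + 1) * ρ) (√n) (D * √n) (by positivity)
    hsn.le ?_ hsignal ?_ (fun j => (hc2 j).le) ?_)
  · have h1 : √(∑ j, (∑ i : Fin n, X i j * ε i ω) ^ 2) ≤ K * (n * ρ) := by
      rw [← hsnp]
      refine Real.sqrt_le_iff.2 ⟨by positivity, hc1.le.trans (le_of_eq ?_)⟩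
      rw [mul_pow, mul_pow, Real.sq_sqrt hn'.le, Real.sq_sqrt hp'.le]
    have h2 : l1 * √(Fintype.card (Fin p)) ≤ n * ρ := by
      rw [Fintype.card_fin, ← hsnp]
      exact mul_le_mul_of_nonneg_right hl1n (Real.sqrt_nonneg _)
    have h3 : (√(∑ j, (∑ i : Fin n, X i j * ε i ω) ^ 2) + l2 * √(∑ j, βs j ^ 2)
        + l1 * √(Fintype.card (Fin p))) / (n * b) ≤ (K + 2) / b * ρ := by
      rw [div_le_iff₀ (by positivity)]
      have : (K + 2) / b * ρ * (n * b) = (K + 2) * (n * ρ) := by field_simp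
      rw [this]; linarith
    have h4 : l2 / n * √(∑ j, βs j ^ 2) ≤ ρ := by
      rw [div_mul_eq_mul_div, div_le_iff₀ hn', mul_comm ρ]
      exact hridge.trans hsnle
    have h5 : 0 ≤ (K + 2) / b * ρ := by positivity
    have h6 : 0 ≤ l2 / (n : ℝ) := by positivity
    calc _ ≤ (1 + l2 / n) * ((K + 2) / b * ρ) + ρ :=
          add_le_add (mul_le_mul_of_nonneg_left h3 (by positivity)) h4
      _ ≤ (1 + 1) * ((K + 2) / b * ρ) + ρ := by gcongr
      _ = _ := by ring
  · intro j hj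
    have hβ : 0 < |βs j| := abs_pos.2 hj
    have h1 := hweight j hj
    rw [Fintype.card_fin, Real.rpow_neg (by positivity), ← div_eq_mul_inv,
      div_le_iff₀ (by positivity), Real.div_rpow hβ.le zero_le_two, mul_div_assoc',
      le_div_iff₀ (by positivity)]
    linarith
  · have h1 : √(n * B / (n * b)) = √(B / b) := by rw [mul_div_mul_left _ _ hn'.ne']
    -- The shift is absorbed by `τ ≤ 1 / n ≤ ρ`.
    have h2 : (2 * (K + 2) / b + 1) * ρ + τ ≤ (2 * (K + 2) / b + 2) * ρ := by
      have : 1 / (n : ℝ) ≤ ρ := by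
        rw [div_le_iff₀ hn', mul_comm]
        exact (Real.one_le_sqrt.2 hn1).trans hsnle
      linarith
    have h3 : ((2 * (K + 2) / b + 2) * ρ) ^ (-γ) ≤ ((2 * (K + 2) / b + 1) * ρ + τ) ^ (-γ) :=
      Real.rpow_le_rpow_of_nonpos (by positivity) h2 (by linarith)
    refine le_trans ?_ (mul_le_mul_of_nonneg_left h3 hl1s.le)
    rw [Real.rpow_neg (by positivity), ← div_eq_mul_inv, le_div_iff₀ (by positivity),
      Real.mul_rpow (by positivity) hρ0.le, h1]
    refine le_trans ?_ hkkt
    have h4 : 2 * (D * √(n : ℝ) + √(B / b) * (l2 * √(∑ j, βs j ^ 2) + √n))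
        ≤ 2 * (1 + 2 * √(B / b)) * (D * √n) := by
      have h5 : √(n : ℝ) ≤ D * √n := le_mul_of_one_le_left hsn.le hD
      have h6 : √(B / b) * (l2 * √(∑ j, βs j ^ 2) + √n) ≤ √(B / b) * (2 * (D * √n)) :=
        mul_le_mul_of_nonneg_left (by linarith) (Real.sqrt_nonneg _)
      linarith
    calc _ ≤ 2 * (1 + 2 * √(B / b)) * (D * √n) * ((2 * (K + 2) / b + 2) ^ γ * ρ ^ γ) :=
          mul_le_mul_of_nonneg_right h4 (by positivity)
      _ = _ := by ring

end FixedSampleSize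

end AdaEnet

namespace AdaEnet

/-! ### Asymptotic comparison of the penalty with powers of `n`. -/

section Rates

lemma eventually_le_rpow_of_tendsto_log_div_log {p : ℕ → ℕ} (hp : ∀ n, 0 < p n) {ν u : ℝ}
    (h : Tendsto (fun n : ℕ => Real.log (p n : ℝ) / Real.log (n : ℝ)) atTop (𝓝 ν)) (hu : ν < u) :
    ∀ᶠ n : ℕ in atTop, (p n : ℝ) ≤ (n : ℝ) ^ u := by
  filter_upwards [h.eventually_lt_const hu, eventually_gt_atTop 1] with n h1 hn
  have hn' : (1 : ℝ) < n := Nat.one_lt_cast.2 hn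
  have hlog := Real.log_pos hn'
  rw [div_lt_iff₀ hlog] at h1
  rw [← Real.log_le_log_iff (Nat.cast_pos.2 (hp n)) (by positivity),
    Real.log_rpow (by linarith)]
  exact h1.le

lemma tendsto_natCast_rpow_neg {e : ℝ} (he : e < 0) (C : ℝ) :
    Tendsto (fun n : ℕ => C * (n : ℝ) ^ e) atTop (𝓝 0) := by
  have h := (tendsto_rpow_neg_atTop (y := -e) (by linarith)).comp
    (tendsto_natCast_atTop_atTop (R := ℝ))
  have := h.const_mul C
  simpa [Function.comp_def] using this

lemma tendsto_natCast_rpow_mul_exp_neg {u v c : ℝ} (hv : 0 < v) (hc : 0 < c) :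
    Tendsto (fun n : ℕ => (n : ℝ) ^ u * Real.exp (-c * (n : ℝ) ^ v)) atTop (𝓝 0) := by
  have h := (tendsto_rpow_mul_exp_neg_mul_atTop_nhds_zero (u / v) c hc).comp
    ((tendsto_rpow_atTop hv).comp (tendsto_natCast_atTop_atTop (R := ℝ)))
  refine h.congr fun n => ?_
  simp only [Function.comp_apply]
  rw [← Real.rpow_mul (Nat.cast_nonneg n), mul_div_cancel₀ _ hv.ne']

lemma sqrt_rpow {x : ℝ} (hx : 0 ≤ x) (γ : ℝ) : √x ^ γ = x ^ (γ / 2) := by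
  rw [Real.sqrt_eq_rpow, ← Real.rpow_mul hx]; ring_nf

variable {p : ℕ → ℕ} {l1s : ℕ → ℝ} {ν γ : ℝ}

lemma eventually_rate_of_bddAbove (hγ : 0 < γ) (hp : BddAbove (Set.range p))
    (hlarge : Tendsto (fun n : ℕ => l1s n / √(n : ℝ) * (n : ℝ) ^ (γ / 2)) atTop atTop) (M : ℝ) :
    ∀ᶠ n : ℕ in atTop, M * √(n : ℝ) * √((p n : ℝ) / n) ^ γ ≤ l1s n := by
  obtain ⟨C, hC⟩ := hp
  filter_upwards [hlarge.eventually_ge_atTop (|M| * (C : ℝ) ^ (γ / 2)), eventually_gt_atTop 0]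
    with n h1 hn
  have hn' : (0 : ℝ) < n := Nat.cast_pos.2 hn
  have hpC : (p n : ℝ) ≤ C := Nat.cast_le.2 (hC ⟨n, rfl⟩)
  have hsn : 0 < √(n : ℝ) := Real.sqrt_pos.2 hn'
  rw [sqrt_rpow (by positivity), Real.div_rpow (by positivity) hn'.le, mul_div_assoc',
    div_le_iff₀ (by positivity)]
  calc M * √(n : ℝ) * (p n : ℝ) ^ (γ / 2) ≤ |M| * √(n : ℝ) * (C : ℝ) ^ (γ / 2) := by
        gcongr; exact le_abs_self M
    _ = √(n : ℝ) * (|M| * (C : ℝ) ^ (γ / 2)) := by ring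
    _ ≤ √(n : ℝ) * (l1s n / √(n : ℝ) * (n : ℝ) ^ (γ / 2)) :=
        mul_le_mul_of_nonneg_left h1 hsn.le
    _ = l1s n * (n : ℝ) ^ (γ / 2) := by field_simp

/-- Exponent count: `p ≤ n ^ (ν + κ / γ)` costs `κ / 2` in `(p / n) ^ (γ / 2)`, while the noise
level gains `κ`. The net factor `n ^ (-κ / 2)` absorbs `M`. -/
lemma eventually_rate_of_growth (hp : ∀ n, 0 < p n) (hγ : 0 < γ) {κ : ℝ} (hκ : 0 < κ)
    (hA4 : Tendsto (fun n : ℕ => Real.log (p n : ℝ) / Real.log (n : ℝ)) atTop (𝓝 ν))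
    (hlarge : Tendsto (fun n : ℕ =>
      l1s n / √(n : ℝ) * (n : ℝ) ^ (((1 - ν) * (1 + γ) - 1) / 2)) atTop atTop) (M : ℝ) :
    ∀ᶠ n : ℕ in atTop,
      M * (n : ℝ) ^ (ν / 2 - κ) * √(n : ℝ) * √((p n : ℝ) / n) ^ γ ≤ l1s n := by
  have hM := (tendsto_natCast_rpow_neg (e := -κ / 2) (by linarith) |M|).eventually_le_const
    zero_lt_one
  filter_upwards [hlarge.eventually_ge_atTop 1, eventually_gt_atTop 0, hM,
    eventually_le_rpow_of_tendsto_log_div_log hp hA4 (u := ν + κ / γ)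
      (by have := div_pos hκ hγ; linarith)] with n h1 hn hM hpn
  have hn' : (0 : ℝ) < n := Nat.cast_pos.2 hn
  have hsn : 0 < √(n : ℝ) := Real.sqrt_pos.2 hn'
  have h2 : √((p n : ℝ) / n) ^ γ ≤ (n : ℝ) ^ ((ν + κ / γ - 1) * (γ / 2)) := by
    rw [sqrt_rpow (by positivity), Real.rpow_mul hn'.le]
    refine Real.rpow_le_rpow (by positivity) ?_ (by positivity)
    rw [Real.rpow_sub_one hn'.ne']
    gcongr
  set e := ((1 - ν) * (1 + γ) - 1) / 2 with he
  have h3 : √(n : ℝ) ≤ l1s n * (n : ℝ) ^ e := by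
    have := mul_le_mul_of_nonneg_left h1 hsn.le
    calc √(n : ℝ) = √(n : ℝ) * 1 := (mul_one _).symm
      _ ≤ _ := this
      _ = _ := by field_simp
  have hne : 0 < (n : ℝ) ^ e := by positivity
  refine le_of_mul_le_mul_right ?_ hne
  refine le_trans ?_ h3
  calc M * (n : ℝ) ^ (ν / 2 - κ) * √(n : ℝ) * √((p n : ℝ) / n) ^ γ * (n : ℝ) ^ e
      ≤ |M| * (n : ℝ) ^ (ν / 2 - κ) * √(n : ℝ) * (n : ℝ) ^ ((ν + κ / γ - 1) * (γ / 2))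
        * (n : ℝ) ^ e := by gcongr; exact le_abs_self M
    _ = √(n : ℝ) * (|M| * ((n : ℝ) ^ (ν / 2 - κ) * (n : ℝ) ^ ((ν + κ / γ - 1) * (γ / 2))
        * (n : ℝ) ^ e)) := by ring
    _ = √(n : ℝ) * (|M| * (n : ℝ) ^ (-κ / 2)) := by
        rw [← Real.rpow_add hn', ← Real.rpow_add hn']
        congr 3
        rw [he]; field_simp; ring
    _ ≤ √(n : ℝ) * 1 := mul_le_mul_of_nonneg_left hM hsn.le
    _ = _ := mul_one _

/-- The beta-min condition, in the form `M * λ₁* * √p ≤ √n * |β j| ^ γ`. -/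
lemma eventually_weight_bound {βs : ∀ n : ℕ, Fin (p n) → ℝ} {l1 : ℕ → ℝ} (hp : ∀ n, 0 < p n)
    (hγ : 0 < γ) (hl1s : ∀ᶠ n : ℕ in atTop, 0 < l1s n)
    (hsignal : Tendsto (fun n : ℕ =>
      min (ENNReal.ofReal (n : ℝ) / ENNReal.ofReal (l1 n * √(p n : ℝ)))
          ((ENNReal.ofReal √(n : ℝ) / ENNReal.ofReal (√(p n : ℝ) * l1s n)) ^ (1 / γ))
        * ⨅ j : Active (βs n), ENNReal.ofReal |βs n j.1|) atTop (𝓝 ∞)) {M : ℝ} (hM : 0 ≤ M) :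
    ∀ᶠ n : ℕ in atTop, ∀ j, βs n j ≠ 0 → M * (l1s n * √(p n : ℝ)) ≤ √(n : ℝ) * |βs n j| ^ γ := by
  filter_upwards [hsignal.eventually_const_lt (ENNReal.ofReal_lt_top (r := M ^ (1 / γ))), hl1s]
    with n h1 hl j hj
  have hsp : 0 < √(p n : ℝ) := Real.sqrt_pos.2 (Nat.cast_pos.2 (hp n))
  have h2 : ENNReal.ofReal (M ^ (1 / γ))
      < (ENNReal.ofReal √(n : ℝ) / ENNReal.ofReal (√(p n : ℝ) * l1s n)) ^ (1 / γ)
        * ENNReal.ofReal |βs n j| :=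
    h1.trans_le (mul_le_mul' (min_le_right _ _) (iInf_le _ (⟨j, hj⟩ : Active (βs n))))
  rw [← ENNReal.ofReal_div_of_pos (by positivity),
    ENNReal.ofReal_rpow_of_nonneg (by positivity) (by positivity),
    ← ENNReal.ofReal_mul (by positivity)] at h2
  have h3 := (ENNReal.ofReal_lt_ofReal_iff_of_nonneg (by positivity)).1 h2
  have h4 := Real.rpow_le_rpow (by positivity) h3.le hγ.le
  rw [Real.mul_rpow (by positivity) (by positivity), ← Real.rpow_mul hM,
    ← Real.rpow_mul (by positivity), one_div_mul_cancel hγ.ne', Real.rpow_one, Real.rpow_one,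
    div_mul_eq_mul_div, le_div_iff₀ (by positivity)] at h4
  linarith

end Rates

/-! ### Choice of the noise level. -/

section NoiseLevel

variable {Ω : Type*} [MeasurableSpace Ω] {P : Measure Ω} [IsProbabilityMeasure P]

/-- A level `D n * √n` that dominates, up to probability `η`, the projected scores, and that is
negligible with respect to the penalty on the inactive coefficients. -/
theorem exists_noise_level {p : ℕ → ℕ} (hp : ∀ n, 0 < p n) {ε : ℕ → Ω → ℝ}
    (hindep : iIndepFun ε P) (hident : ∀ i, IdentDistrib (ε i) (ε 0) P P)
    (hL2 : MemLp (ε 0) 2 P) (hmean : ∫ ω, ε 0 ω ∂P = 0)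
    {l1s : ℕ → ℝ} {B ν γ δ : ℝ} (hB : 0 < B) (hδ : 0 < δ)
    (hmom : Integrable (fun ω => |ε 0 ω| ^ (2 + δ)) P) (hν0 : 0 ≤ ν)
    (hA4 : Tendsto (fun n : ℕ => Real.log (p n : ℝ) / Real.log (n : ℝ)) atTop (𝓝 ν))
    (hA4_zero : ν = 0 → BddAbove (Set.range p)) (hγ : 0 < γ)
    (hlarge : Tendsto (fun n : ℕ =>
      l1s n / √(n : ℝ) * (n : ℝ) ^ (((1 - ν) * (1 + γ) - 1) / 2)) atTop atTop)
    {η : ℝ} (hη : 0 < η) :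
    ∃ D : ℕ → ℝ, (∀ᶠ n in atTop, 1 ≤ D n) ∧
      (∀ M, ∀ᶠ n : ℕ in atTop, M * D n * √(n : ℝ) * √((p n : ℝ) / n) ^ γ ≤ l1s n) ∧
      ∀ᶠ n : ℕ in atTop, ∀ a : Fin (p n) → Fin n → ℝ, (∀ j, ∑ i, a j i ^ 2 ≤ n * B) →
        P.real {ω | ∃ j, D n * √(n : ℝ) ≤ |∑ i, a j i * ε i ω|} ≤ η := by
  rcases hν0.eq_or_lt with hν | hν
  · have hbdd := hA4_zero hν.symm
    have hlarge' : Tendsto (fun n : ℕ => l1s n / √(n : ℝ) * (n : ℝ) ^ (γ / 2)) atTop atTop := by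
      refine hlarge.congr fun n => ?_
      rw [← hν]; ring_nf
    obtain ⟨C, hC⟩ := hbdd
    set V := Var[ε 0; P]
    have hV0 : 0 ≤ V := variance_nonneg _ _
    have hK1 : 0 ≤ C * (V * B) / η := by positivity
    -- Chebyshev needs `C * V * B ≤ η * D²`; `D = 1 + x` with `x = C * V * B / η` works since `x ≤
    -- (1 + x)²`.
    refine ⟨fun _ => 1 + C * (V * B) / η, Eventually.of_forall fun n => by linarith,
      fun M => eventually_rate_of_bddAbove hγ ⟨C, hC⟩ hlarge' _, ?_⟩
    filter_upwards [eventually_gt_atTop 0] with n hn a ha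
    have hn' : (0 : ℝ) < n := Nat.cast_pos.2 hn
    have hsn : 0 < √(n : ℝ) := Real.sqrt_pos.2 hn'
    have hpC : (p n : ℝ) ≤ C := Nat.cast_le.2 (hC ⟨n, rfl⟩)
    refine (measureReal_exists_le_abs_linear_form hindep (fun i => (hident i).memLp_iff.2 hL2)
      (fun i => (hident i).integral_eq.trans hmean) (fun i => (hident i).variance_eq.le) hV0 ha
      (by positivity)).trans ?_
    rw [Fintype.card_fin, mul_pow, Real.sq_sqrt hn'.le, div_le_iff₀ (by positivity)]
    have h1 : C * (V * B) ≤ η * (1 + C * (V * B) / η) ^ 2 := by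
      have h2 : C * (V * B) = η * (C * (V * B) / η) := by field_simp
      have h3 : C * (V * B) / η ≤ (1 + C * (V * B) / η) ^ 2 := by nlinarith
      calc C * (V * B) = η * (C * (V * B) / η) := h2
        _ ≤ _ := mul_le_mul_of_nonneg_left h3 hη.le
    calc (p n : ℝ) * (V * (n * B)) ≤ C * (V * (n * B)) :=
          mul_le_mul_of_nonneg_right hpC (by positivity)
      _ = n * (C * (V * B)) := by ring
      _ ≤ n * (η * (1 + C * (V * B) / η) ^ 2) := mul_le_mul_of_nonneg_left h1 hn'.le
      _ = _ := by ring
  -- The first bound on `κ` keeps the Hoeffding exponent `ν / 2 - 2 * κ` positive and `D ≥ 1`; the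
  -- second makes the Chebyshev term for the truncated tail vanish.
  · obtain ⟨κ, hκ0, hκ1, hκ2⟩ : ∃ κ : ℝ, 0 < κ ∧ κ ≤ ν / 8 ∧ κ / γ + 2 * κ < δ * (ν / 4) := by
      refine ⟨min (ν / 8) (δ * (ν / 4) / (1 / γ + 2) / 2), by positivity, min_le_left _ _, ?_⟩
      have h1 := min_le_right (ν / 8) (δ * (ν / 4) / (1 / γ + 2) / 2)
      set κ := min (ν / 8) (δ * (ν / 4) / (1 / γ + 2) / 2)
      have h2 : κ / γ + 2 * κ = κ * (1 / γ + 2) := by ring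
      have h3 : δ * (ν / 4) / (1 / γ + 2) / 2 * (1 / γ + 2) = δ * (ν / 4) / 2 := by field_simp
      have h4 := mul_le_mul_of_nonneg_right h1 (by positivity : 0 ≤ 1 / γ + 2)
      have : 0 < δ * (ν / 4) := by positivity
      linarith
    refine ⟨fun n => (n : ℝ) ^ (ν / 2 - κ), ?_,
      eventually_rate_of_growth hp hγ hκ0 hA4 hlarge, ?_⟩
    · filter_upwards [eventually_gt_atTop 0] with n hn
      exact Real.one_le_rpow (Nat.one_le_cast.2 hn) (by linarith)
    set m := ∫ ω, |ε 0 ω| ^ (2 + δ) ∂P with hm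
    have hm0 : 0 ≤ m := integral_nonneg fun ω => by positivity
    have t1 := ((tendsto_natCast_rpow_mul_exp_neg (u := ν + κ / γ) (v := ν / 2 - 2 * κ)
      (c := 1 / (8 * B)) (by linarith) (by positivity)).const_mul 2).eventually_le_const
      (by rw [mul_zero]; exact half_pos hη : 2 * 0 < η / 2)
    have t2 := (tendsto_natCast_rpow_neg (e := κ / γ + 2 * κ - δ * (ν / 4)) (by linarith)
      (4 * m * B)).eventually_le_const (half_pos hη)
    filter_upwards [t1, t2, eventually_gt_atTop 0,
      eventually_le_rpow_of_tendsto_log_div_log hp hA4 (u := ν + κ / γ)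
      (by have := div_pos hκ0 hγ; linarith)] with n t1 t2 hn hpn a ha
    have hn' : (0 : ℝ) < n := Nat.cast_pos.2 hn
    have hsn : 0 < √(n : ℝ) := Real.sqrt_pos.2 hn'
    -- With `T = n ^ (ν / 4)`, `D² / T²` is still a positive power of `n`, so the exponential beats
    -- `p`, while `T ^ (-δ)` makes `p * T ^ (-δ) / D²` tend to zero.
    refine (measureReal_exists_le_abs_linear_form_of_moment (T := (n : ℝ) ^ (ν / 4)) hindep hident
      hL2 hmean hδ hmom ha (by positivity) (by positivity) (by positivity)).trans ?_
    have hs : ((n : ℝ) ^ (ν / 2 - κ) * √(n : ℝ) / 2) ^ 2 = (n : ℝ) ^ (ν - 2 * κ) * n / 4 := by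
      rw [div_pow, mul_pow, Real.sq_sqrt hn'.le, ← Real.rpow_mul_natCast hn'.le,
        show (ν / 2 - κ) * ((2 : ℕ) : ℝ) = ν - 2 * κ by push_cast; ring]
      norm_num
    have hT2 : ((n : ℝ) ^ (ν / 4)) ^ 2 = (n : ℝ) ^ (ν / 2) := by
      rw [← Real.rpow_mul_natCast hn'.le]; congr 1; push_cast; ring
    have hTδ : ((n : ℝ) ^ (ν / 4)) ^ (-δ) = (n : ℝ) ^ (-(δ * (ν / 4))) := by
      rw [← Real.rpow_mul hn'.le]; ring_nf
    rw [Fintype.card_fin, hs, hT2, hTδ, ← hm]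
    have e1 : -((n : ℝ) ^ (ν - 2 * κ) * n / 4) / (2 * (n * B * (n : ℝ) ^ (ν / 2)))
        = -(1 / (8 * B)) * (n : ℝ) ^ (ν / 2 - 2 * κ) := by
      have : (n : ℝ) ^ (ν - 2 * κ) = (n : ℝ) ^ (ν / 2 - 2 * κ) * (n : ℝ) ^ (ν / 2) := by
        rw [← Real.rpow_add hn']; ring_nf
      have hpos : (n : ℝ) ^ (ν / 2) ≠ 0 := by positivity
      rw [this]; field_simp; norm_num
    have e2 : (n : ℝ) ^ (ν + κ / γ) * (m * (n : ℝ) ^ (-(δ * (ν / 4))) * (n * B))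
          / ((n : ℝ) ^ (ν - 2 * κ) * n / 4)
        = 4 * m * B * (n : ℝ) ^ (κ / γ + 2 * κ - δ * (ν / 4)) := by
      have : (n : ℝ) ^ (ν + κ / γ) * (n : ℝ) ^ (-(δ * (ν / 4)))
          = (n : ℝ) ^ (κ / γ + 2 * κ - δ * (ν / 4)) * (n : ℝ) ^ (ν - 2 * κ) := by
        rw [← Real.rpow_add hn', ← Real.rpow_add hn']; ring_nf
      rw [div_eq_iff (by positivity)]
      linear_combination (m * n * B) * this
    rw [e1]
    have b1 : (p n : ℝ) * (2 * Real.exp (-(1 / (8 * B)) * (n : ℝ) ^ (ν / 2 - 2 * κ))) ≤ η / 2 := by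
      refine le_trans ?_ t1
      have := mul_le_mul_of_nonneg_right hpn
        (Real.exp_pos (-(1 / (8 * B)) * (n : ℝ) ^ (ν / 2 - 2 * κ))).le
      linarith
    have b2 : (p n : ℝ) * (m * (n : ℝ) ^ (-(δ * (ν / 4))) * (n * B))
          / ((n : ℝ) ^ (ν - 2 * κ) * n / 4) ≤ η / 2 := by
      refine le_trans ?_ (e2.le.trans t2)
      gcongr
    linarith

end NoiseLevel

end AdaEnet

/-! ### Assembly of the bounds. -/

theorem theorem3p2
    {Ω : Type*} [MeasurableSpace Ω] (P : Measure Ω) [IsProbabilityMeasure P]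
    -- dimensions, fixed designs and true coefficients, for every sample size `n`
    (p : ℕ → ℕ) (hp : ∀ n, 0 < p n)
    (X : ∀ n : ℕ, Matrix (Fin n) (Fin (p n)) ℝ) (βs : ∀ n : ℕ, Fin (p n) → ℝ)
    -- i.i.d. errors with mean zero and finite variance
    (ε : ℕ → Ω → ℝ) (σ : ℝ)
    (hε_indep : iIndepFun ε P) (hε_ident : ∀ i, IdentDistrib (ε i) (ε 0) P P)
    (hε_L2 : MemLp (ε 0) 2 P) (hε_mean : ∫ ω, ε 0 ω ∂P = 0)
    (hε_var : Var[ε 0; P] = σ ^ 2)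
    -- tuning parameters
    (l1 l2 l1s : ℕ → ℝ)
    (hl1 : ∀ n, 0 ≤ l1 n) (hl2 : ∀ n, 0 ≤ l2 n) (hl1s : ∀ n, 0 ≤ l1s n)
    -- all eigenvalues of `Xᵀ X / n` lie in `[b, B]`
    (b B : ℝ) (hb : 0 < b) (hB : 0 < B)
    (hA1 : ∀ᶠ n : ℕ in atTop,
      spectrum ℝ ((1 / (n : ℝ)) • ((X n)ᵀ * X n)) ⊆ Set.Icc b B)
    -- no single observation dominates the design
    (hA2 : Tendsto (fun n : ℕ => (⨆ i : Fin n, ∑ j, X n i j ^ 2) / (n : ℝ)) atTop (𝓝 0))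
    -- a moment of order above two
    (hA3 : ∃ δ : ℝ, 0 < δ ∧ Integrable (fun ω => |ε 0 ω| ^ (2 + δ)) P)
    -- polynomial growth of the dimension, where `ν = 0` is the finite dimensional setting
    (ν : ℝ) (hν0 : 0 ≤ ν) (hν1 : ν < 1)
    (hA4 : Tendsto (fun n : ℕ => Real.log (p n : ℝ) / Real.log (n : ℝ)) atTop (𝓝 ν))
    (hA4_zero : ν = 0 → BddAbove (Set.range p))
    -- exponent of the weights
    (γ : ℝ) (hγ : 2 * ν / (1 - ν) < γ)
    -- rates of the elastic-net parameters
    (hA5_l2 : Tendsto (fun n : ℕ => l2 n / (n : ℝ)) atTop (𝓝 0))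
    (hA5_l1 : Tendsto (fun n : ℕ => l1 n / √(n : ℝ)) atTop (𝓝 0))
    -- rates of the adaptive parameter; in the last condition `1 / 0 = ∞` and the minimum over the empty set is `∞`
    (hA6_small : Tendsto (fun n : ℕ => l1s n / √(n : ℝ)) atTop (𝓝 0))
    (hA6_large : Tendsto (fun n : ℕ =>
      l1s n / √(n : ℝ) * (n : ℝ) ^ (((1 - ν) * (1 + γ) - 1) / 2)) atTop atTop)
    (hA6_ridge : Tendsto (fun n : ℕ =>
      l2 n / √(n : ℝ) * √(∑ j : AdaEnet.Active (βs n), βs n j.1 ^ 2)) atTop (𝓝 0))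
    (hA6_signal : Tendsto (fun n : ℕ =>
      min (ENNReal.ofReal (n : ℝ) / ENNReal.ofReal (l1 n * √(p n : ℝ)))
          ((ENNReal.ofReal √(n : ℝ) / ENNReal.ofReal (√(p n : ℝ) * l1s n)) ^ (1 / γ))
        * ⨅ j : AdaEnet.Active (βs n), ENNReal.ofReal |βs n j.1|) atTop (𝓝 ∞))
    -- weights `|b j| ^ (-γ)` with value `∞` at zero, or weights `(|b j| + 1 / n) ^ (-γ)`
    (τ : ℕ → ℝ) (hτ : (∀ n, τ n = 0) ∨ (∀ n : ℕ, τ n = 1 / (n : ℝ))) :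
    -- the (outer) probability of the complementary event tends to zero
    Tendsto (fun n : ℕ => P {ω | ¬ AdaEnet.OracleSolves (X n) (βs n)
        (AdaEnet.response (X n) (βs n) (fun i => ε i ω))
        (l2 n) (l1 n) (l1s n) γ (τ n)}) atTop (𝓝 0) := by
  have hγ0 : 0 < γ := lt_of_le_of_lt (div_nonneg (by linarith) (by linarith)) hγ
  obtain ⟨δ, hδ, hmom⟩ := hA3
  rw [ENNReal.tendsto_nhds_zero]
  intro r hr
  obtain ⟨η, hη0, hηr⟩ : ∃ η : ℝ, 0 < η ∧ ENNReal.ofReal (η + η) ≤ r := by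
    obtain ⟨s, hs0, hsr⟩ := ENNReal.lt_iff_exists_nnreal_btwn.1 hr
    refine ⟨s / 2, half_pos (by exact_mod_cast hs0), ?_⟩
    rw [add_halves, ENNReal.ofReal_coe_nnreal]
    exact hsr.le
  obtain ⟨D, hD1, hDrate, hDnoise⟩ := AdaEnet.exists_noise_level hp hε_indep hε_ident hε_L2 hε_mean
    hB hδ hmom hν0 hA4 hA4_zero hγ0 hA6_large hη0
  -- Chosen so that `σ² B = η (K - 1) ≤ η K²`.
  set K := 1 + σ ^ 2 * B / η with hK
  have hK1 : 1 ≤ K := by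
    have : 0 ≤ σ ^ 2 * B / η := by positivity
    linarith
  have hKη : σ ^ 2 * B / K ^ 2 ≤ η := by
    rw [div_le_iff₀ (by positivity)]
    have h1 : σ ^ 2 * B = η * (K - 1) := by rw [hK]; field_simp; ring
    rw [h1]
    exact mul_le_mul_of_nonneg_left (by nlinarith) hη0.le
  have hl1s_pos : ∀ᶠ n : ℕ in atTop, 0 < l1s n := by
    filter_upwards [hDrate 1, hD1, eventually_gt_atTop 0] with n h1 h2 hn
    have hn' : (0 : ℝ) < n := Nat.cast_pos.2 hn
    have hp' : (0 : ℝ) < p n := Nat.cast_pos.2 (hp n)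
    have h3 : 0 < D n := by linarith
    have h4 : 0 < √((p n : ℝ) / n) := by positivity
    exact lt_of_lt_of_le (by positivity) h1
  set M := 2 * (2 * (K + 2) / b + 1) with hM
  have hM0 : 0 < M := by positivity
  filter_upwards [hA1, hD1, hDrate (2 * (1 + 2 * √(B / b)) * (2 * (K + 2) / b + 2) ^ γ),
    hDrate (M ^ γ), hDnoise, hl1s_pos, eventually_gt_atTop 0,
    hA5_l2.eventually_le_const zero_lt_one, hA5_l1.eventually_le_const zero_lt_one,
    hA6_ridge.eventually_le_const zero_lt_one,
    AdaEnet.eventually_weight_bound hp hγ0 hl1s_pos hA6_signal zero_le_one,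
    AdaEnet.eventually_weight_bound hp hγ0 hl1s_pos hA6_signal
      (Real.rpow_nonneg zero_le_two γ)] with n hspec hD hkkt hrate hnoise hl1s' hn hl2n hl1n hridge
    hweight1 hweight
  have hn' : (0 : ℝ) < n := Nat.cast_pos.2 hn
  have hp' : (0 : ℝ) < p n := Nat.cast_pos.2 (hp n)
  have hsn : 0 < √(n : ℝ) := Real.sqrt_pos.2 hn'
  have hτ' : 0 ≤ τ n ∧ τ n ≤ 1 / (n : ℝ) := by
    rcases hτ with h | h
    · rw [h]; exact ⟨le_rfl, by positivity⟩
    · rw [h]; exact ⟨by positivity, le_rfl⟩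
  refine le_trans (AdaEnet.measure_not_oracleSolves_le (V := σ ^ 2) (K := K) (D := D n) (q := η)
    hn (hp n) hε_indep (fun i => (hε_ident i).memLp_iff.2 hε_L2)
    (fun i => (hε_ident i).integral_eq.trans hε_mean)
    (fun i => ((hε_ident i).variance_eq.trans hε_var).le) (sq_nonneg σ) (hl2 n) (hl1 n) hl1s' hγ0
    hτ'.1 hτ'.2 hb (by linarith) hD hspec hl2n ?_ ?_ ?_ hweight hkkt hnoise)
    ((ENNReal.ofReal_le_ofReal (by linarith)).trans hηr)
  · have h1 : ∑ j : AdaEnet.Active (βs n), βs n j.1 ^ 2 = ∑ j, βs n j ^ 2 := by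
      rw [← AdaEnet.sum_zeroExtend_sq, AdaEnet.zeroExtend_restrict]
    rw [h1, div_mul_eq_mul_div, div_le_one hsn] at hridge
    exact hridge
  · rwa [div_le_one hsn] at hl1n
  · intro j hj
    have h1 := hweight1 j hj
    have hsp : 1 ≤ √(p n : ℝ) := Real.one_le_sqrt.2 (Nat.one_le_cast.2 (hp n))
    have hρ : 0 ≤ √((p n : ℝ) / n) := Real.sqrt_nonneg _
    -- The separation `2 * R ≤ |βs j|` comes from squeezing `l1s`: it is at least `√n (M √(p / n)) ^
    -- γ` by the rate and at most `√n |βs j| ^ γ` by beta-min.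
    have h2 : √(n : ℝ) * (M * √((p n : ℝ) / n)) ^ γ ≤ √(n : ℝ) * |βs n j| ^ γ := by
      rw [Real.mul_rpow hM0.le hρ]
      have h3 : l1s n ≤ l1s n * √(p n : ℝ) := le_mul_of_one_le_right hl1s'.le hsp
      have h4 : M ^ γ * √(n : ℝ) * √((p n : ℝ) / n) ^ γ
          ≤ M ^ γ * D n * √(n : ℝ) * √((p n : ℝ) / n) ^ γ := by
        gcongr
        exact le_mul_of_one_le_right (by positivity) hD
      linarith
    have h5 := (Real.rpow_le_rpow_iff (by positivity) (abs_nonneg _) hγ0).1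
      (le_of_mul_le_mul_left h2 hsn)
    linarith
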